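/- **Theorem (Critical $L^n$ Hardy inequalities on the sphere).** Let $n\ge 2$, let $\mathbb S^n$ be the unit sphere of $\mathbb R^{n+1}$ with surface measure $\sigma_n$, fix any point $\Phi\in\mathbb S^n$, and let $d=d(x)=\arccos(x\cdot\Phi)$ be the geodesic distance from $\Phi$. Put $\gamma_n=\frac{n-1}{n}$. A function $u\in L^1(\mathbb S^n)$ has weak surface gradient $\nabla u$ if $\nabla u$ is an integrable tangential vector field with $\int_{\mathbb S^n}\nabla u\cdot V\,d\sigma_n=-\int_{\mathbb S^n}u\,(\nabla\cdot V)\,d\sigma_n$ for all smooth tangential vector fields $V$ on $\mathbb S^n$ ($\nabla\cdot$ being the surface divergence), and $W^{1,n}(\mathbb S^n)$ is the set of real $u\in L^n(\mathbb S^n)$ that have a weak surface gradient with $|\nabla u|\in L^n(\mathbb S^n)$. Let $u\in W^{1,n}(\mathbb S^n)$. Then $$\frac{u}{\sin d\,\log\frac{e}{\sin d}}\in L^n(\mathbb S^n),\qquad \frac{u}{\tan d\,\log\frac{e}{\sin d}}\in L^n(\mathbb S^n),$$ all the integrals below are finite, and $$\gamma_n^n\int_{\mathbb S^n}\frac{|u|^n}{\sin^n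 d\,\left(\log\frac{e}{\sin d}\right)^n}\,d\sigma_n\le\int_{\mathbb S^n}|\nabla u|^n|\cos d|^n\,d\sigma_n+n\gamma_n^{n-1}\int_{\mathbb S^n}\frac{|u|^n}{\sin^{n-2}d\,\left(\log\frac{e}{\sin d}\right)^{n-1}}\,d\sigma_n,$$ $$\gamma_n^n\int_{\mathbb S^n}\frac{|u|^n}{|\tan d|^n\left(\log\frac{e}{\sin d}\right)^n}\,d\sigma_n\le\int_{\mathbb S^n}|\nabla u|^n\,d\sigma_n+(n-1)\gamma_n^{n-1}\int_{\mathbb S^n}\frac{|u|^n}{|\tan d|^{n-2}\left(\log\frac{e}{\sin d}\right)^{n-1}}\,d\sigma_n.$$ -/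

import Mathlib

open MeasureTheory Metric
open scoped Manifold ContDiff

namespace SphereHardy

noncomputable section

/-- Euclidean space `ℝ^{n+1}`. -/
abbrev Ambient (n : ℕ) : Type := EuclideanSpace ℝ (Fin (n + 1))

/-- The unit sphere `𝕊^n` of `ℝ^{n+1}`. -/
abbrev Sph (n : ℕ) : Type := sphere (0 : Ambient n) 1

/-- The surface measure `σ_n` on `𝕊^n`. -/
def surf (n : ℕ) : Measure (Sph n) := (volume : Measure (Ambient n)).toSphere

/-- The geodesic distance on `𝕊^n`, `d(x, Φ) = arccos (x · Φ)`. -/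
def geoDist {n : ℕ} (Φ x : Sph n) : ℝ :=
  Real.arccos (inner ℝ (x : Ambient n) (Φ : Ambient n))

/-- The logarithmic weight `log (e / sin d(x, Φ))`. -/
def logWeight {n : ℕ} (Φ x : Sph n) : ℝ :=
  Real.log (Real.exp 1 / Real.sin (geoDist Φ x))

/-- Smooth tangential vector fields on `𝕊^n`: smooth maps `V : 𝕊^n → ℝ^{n+1}` on the manifold `𝕊^n`
with `V x` orthogonal to `x`, i.e. in the tangent space `T_x 𝕊^n = x^⊥`, at every point `x`. -/
structure IsSmoothTangentField {n : ℕ} (V : Sph n → Ambient n) : Prop where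
  smooth : ContMDiff (𝓡 n) 𝓘(ℝ, Ambient n) ∞ V
  tangent : ∀ x : Sph n, inner ℝ (x : Ambient n) (V x) = 0

/-- The radial projection `y ↦ y / |y|` of `ℝ^{n+1} \ {0}` to `𝕊^n`. -/
def radialProj {n : ℕ} (y : Ambient n) (hy : y ≠ 0) : Sph n :=
  ⟨‖y‖⁻¹ • y, by
    rw [mem_sphere_zero_iff_norm, norm_smul, norm_inv, norm_norm,
      inv_mul_cancel₀ (norm_ne_zero_iff.mpr hy)]⟩

open Classical in
/-- The extension `y ↦ V (y / |y|)` of a field on the sphere to `ℝ^{n+1} \ {0}`,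
constant along rays (with value `0` at the origin). -/
def radialExt {n : ℕ} (V : Sph n → Ambient n) (y : Ambient n) : Ambient n :=
  if hy : y ≠ 0 then V (radialProj y hy) else 0

/-- The surface divergence `∇ · V` at `x ∈ 𝕊^n` of a smooth tangential field `V`: the trace of the
derivative of `V` along `T_x 𝕊^n`. The extension of `V` that is constant along rays has vanishing
radial derivative, so this is the full trace of the derivative of the extension at `x`. -/
def surfDiv {n : ℕ} (V : Sph n → Ambient n) (x : Sph n) : ℝ :=
  LinearMap.trace ℝ (Ambient n)
    (fderiv ℝ (radialExt V) (x : Ambient n)).toLinearMap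

/-- `Ψ` is the weak surface gradient of `u ∈ L^1(𝕊^n)`: an integrable tangential field with
`∫ Ψ · V dσ = - ∫ u (∇ · V) dσ` for all smooth tangential fields `V`. -/
structure IsWeakGradient {n : ℕ} (u : Sph n → ℝ) (Ψ : Sph n → Ambient n) : Prop where
  integrable_fun : Integrable u (surf n)
  integrable_grad : Integrable Ψ (surf n)
  tangent : ∀ᵐ x : Sph n ∂(surf n), inner ℝ (x : Ambient n) (Ψ x) = 0
  integral_eq : ∀ V : Sph n → Ambient n, IsSmoothTangentField V →
    ∫ x, inner ℝ (Ψ x) (V x) ∂(surf n) = - ∫ x, u x * surfDiv V x ∂(surf n)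

/-- `u ∈ W^{1,p}(𝕊^n)`: `u` is in `L^p` and has a weak surface gradient in `L^p`. -/
def MemSobolev {n : ℕ} (u : Sph n → ℝ) (p : ENNReal) : Prop :=
  MemLp u p (surf n) ∧ ∃ Ψ : Sph n → Ambient n, IsWeakGradient u Ψ ∧ MemLp Ψ p (surf n)

/-- Integrand of `U_n(u)`. -/
def densU {n : ℕ} (Φ : Sph n) (u : Sph n → ℝ) (x : Sph n) : ℝ :=
  |u x| ^ n / (Real.sin (geoDist Φ x) ^ n * logWeight Φ x ^ n)

/-- Integrand of `Ũ_n(u)`, for `n ≥ 2`. -/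
def densUt {n : ℕ} (Φ : Sph n) (u : Sph n → ℝ) (x : Sph n) : ℝ :=
  |u x| ^ n / (Real.sin (geoDist Φ x) ^ (n - 2) * logWeight Φ x ^ (n - 1))

/-- Integrand of `V_n(u)`. -/
def densV {n : ℕ} (Φ : Sph n) (u : Sph n → ℝ) (x : Sph n) : ℝ :=
  |u x| ^ n / (|Real.tan (geoDist Φ x)| ^ n * logWeight Φ x ^ n)

/-- Integrand of `Ṽ_n(u)`, for `n ≥ 2`. -/
def densVt {n : ℕ} (Φ : Sph n) (u : Sph n → ℝ) (x : Sph n) : ℝ :=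
  |u x| ^ n / (|Real.tan (geoDist Φ x)| ^ (n - 2) * logWeight Φ x ^ (n - 1))

/-- Integrand of `H_n(u)`, in terms of the weak gradient `Ψ` of `u`. -/
def densH {n : ℕ} (Ψ : Sph n → Ambient n) (x : Sph n) : ℝ := ‖Ψ x‖ ^ n

/-- Integrand of `Q_n(u)`, in terms of the weak gradient `Ψ` of `u`. -/
def densQ {n : ℕ} (Φ : Sph n) (Ψ : Sph n → Ambient n) (x : Sph n) : ℝ :=
  ‖Ψ x‖ ^ n * |Real.cos (geoDist Φ x)| ^ n

/-- The constant `γ_n = (n - 1) / n`. -/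
def gam (n : ℕ) : ℝ := ((n : ℝ) - 1) / n

end

end SphereHardy

/-! Write `c = cos d`, `s = sin d`, `L = log (e / s)`, `γ = (n - 1) / n`. Both inequalities come
from integrating `|u| ^ n` by parts against a zonal field `h(c) (Φ - c x)` and applying Young's
inequality. For `h = -m(c) / (s ^ n L ^ (n - 1))` the terms in which `s ^ n` is differentiated
cancel, and the divergence away from the poles is `(n - 1) c m / (s ^ n L ^ n) - m' / (s ^ (n - 2) L
^ (n - 1))`. As `|Φ - c x| = s`, a factorisation `|m| = α β ^ (n - 1)` lets Young's inequality bound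
the gradient term, after scaling by `γ ^ (n - 1)`, by `(|∇u| α) ^ n + (n - 1) γ ^ n |u| ^ n β ^ n /
(s ^ n L ^ n)`. The relation `n γ = n - 1` turns `(n - 1) γ ^ (n - 1) - (n - 1) γ ^ n` into the
constant `γ ^ n`. The choice `m = c`, `α = |c|`, `β = 1` gives the first inequality; `m = |c| ^ (n -
2) c`, `α = 1`, `β = |c|` gives the second.

The field is singular at the poles, so `h` carries a cutoff, whose derivative contributes with the
favourable sign because `c m ≥ 0` (`le_div_profile`). The cutoff inequality (`integral_cut_le`)
bounds the singular integrals uniformly; Fatou's lemma then gives integrability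
(`integrable_densU`), and dominated convergence removes the cutoff.

Integration by parts for `|u| ^ n` is proved without smoothing `u`. The zonal field is a combination
of rotation generators (`integral_abs_pow_mul_zonal`). A weak derivative in `L^p` along a rotation
flow is a true `L^p` derivative of the rotated functions (`hasDerivAt_toLp_comp_rot`). Convexity of
`|·| ^ n` then gives a function of time that is minimal at `0`, and its vanishing derivative is the
chain rule (`integral_abs_pow_mul_fderiv`). -/

namespace SphereHardy

noncomputable section

/-! ### Rotation flows on the sphere. -/

/-- The one-parameter group `exp (t A)` generated by a linear map `A`. -/
def flow {E : Type*} [NormedAddCommGroup E] [NormedSpace ℝ E] (A : E →L[ℝ] E) (t : ℝ) :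
    E →L[ℝ] E :=
  NormedSpace.exp (t • A)

section Flow

variable {E : Type*} [NormedAddCommGroup E] [InnerProductSpace ℝ E]
  {A : E →L[ℝ] E}

theorem flow_zero : flow A 0 = 1 := by simp [flow]

variable [FiniteDimensional ℝ E]

theorem flow_add (s t : ℝ) : flow A (s + t) = flow A s * flow A t := by
  unfold flow
  rw [add_smul]
  let _ : NormedAlgebra ℚ (E →L[ℝ] E) := NormedAlgebra.restrictScalars ℚ ℝ _
  have := FiniteDimensional.complete ℝ E
  exact NormedSpace.exp_add_of_commute (((Commute.refl A).smul_left s).smul_right t)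

theorem hasDerivAt_flow_apply (x : E) (t : ℝ) :
    HasDerivAt (fun t => flow A t x) (A (flow A t x)) t := by
  have := FiniteDimensional.complete ℝ E
  have h : HasDerivAt (flow A) (A * flow A t) t := hasDerivAt_exp_smul_const' (𝕂 := ℝ) A t
  simpa using h.clm_apply (hasDerivAt_const t x)

theorem flow_apply_comm (t : ℝ) (x : E) : A (flow A t x) = flow A t (A x) := by
  have := FiniteDimensional.complete ℝ E
  have h := (hasDerivAt_exp_smul_const (𝕂 := ℝ) A t).unique
    (hasDerivAt_exp_smul_const' (𝕂 := ℝ) A t)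
  exact (DFunLike.congr_fun h x).symm

theorem continuous_flow : Continuous (flow A) :=
  have := FiniteDimensional.complete ℝ E
  (differentiable_exp_smul_const ℝ A).continuous

theorem norm_flow_apply (hA : ∀ x, inner ℝ x (A x) = 0) (t : ℝ) (x : E) :
    ‖flow A t x‖ = ‖x‖ := by
  have hd : ∀ t, HasDerivAt (fun t => ‖flow A t x‖ ^ 2) 0 t := fun t => by
    have h := (hasDerivAt_flow_apply (A := A) x t).norm_sq
    rwa [hA, mul_zero] at h
  have h := is_const_of_deriv_eq_zero (fun t => (hd t).differentiableAt)
    (fun t => (hd t).deriv) t 0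
  simp only [flow_zero, one_apply_eq_self] at h
  exact (sq_eq_sq₀ (norm_nonneg _) (norm_nonneg _)).1 h

end Flow

variable {n : ℕ} {A : Ambient n →L[ℝ] Ambient n}

/-- `exp (t A)` for skew-adjoint `A` as an isometry. -/
def flowIso (hA : ∀ x, inner ℝ x (A x) = 0) (t : ℝ) : Ambient n ≃ₗᵢ[ℝ] Ambient n :=
  LinearIsometry.toLinearIsometryEquiv
    ⟨(flow A t : Ambient n →ₗ[ℝ] Ambient n), norm_flow_apply hA t⟩ rfl

/-- The self-map of the sphere induced by a linear isometry. -/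
def sphMap (R : Ambient n ≃ₗᵢ[ℝ] Ambient n) : C(Sph n, Sph n) where
  toFun x := ⟨R x, by simp⟩
  continuous_toFun := by fun_prop

theorem coe_sphMap (R : Ambient n ≃ₗᵢ[ℝ] Ambient n) (x : Sph n) :
    (sphMap R x : Ambient n) = R x := rfl

-- The surface measure of a set is a multiple of the Lebesgue measure of the cone over it, and a
-- linear isometry maps cones to cones and preserves Lebesgue measure.
open scoped Pointwise in
theorem measurePreserving_sphMap (R : Ambient n ≃ₗᵢ[ℝ] Ambient n) :
    MeasurePreserving (sphMap R) (surf n) (surf n) := by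
  refine ⟨(sphMap R).continuous.measurable, ?_⟩
  ext s hs
  have hm := (sphMap R).continuous.measurable
  rw [Measure.map_apply hm hs, surf, Measure.toSphere_apply' _ (hm hs),
    Measure.toSphere_apply' _ hs]
  congr 1
  have key : Set.Ioo (0 : ℝ) 1 • ((↑) '' (sphMap R ⁻¹' s) : Set (Ambient n))
      = R ⁻¹' (Set.Ioo (0 : ℝ) 1 • ((↑) '' s : Set (Ambient n))) := by
    ext y
    simp only [Set.mem_smul, Set.mem_image, Set.mem_preimage]
    constructor
    · rintro ⟨r, hr, _, ⟨x, hx, rfl⟩, rfl⟩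
      exact ⟨r, hr, _, ⟨_, hx, rfl⟩, by simp [coe_sphMap]⟩
    · rintro ⟨r, hr, _, ⟨x, hx, rfl⟩, h⟩
      refine ⟨r, hr, _, ⟨sphMap R.symm x, ?_, rfl⟩, ?_⟩
      · have : sphMap R (sphMap R.symm x) = x := Subtype.ext (by simp [coe_sphMap])
        rwa [this]
      · apply R.injective
        simp [coe_sphMap, h]
  rw [key]
  exact (R.measurePreserving).measure_preimage_emb R.toHomeomorph.measurableEmbedding _

instance : IsFiniteMeasure (surf n) := by unfold surf; infer_instance

/-- The rotation flow on the sphere generated by a skew-adjoint `A`. -/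
def rot (hA : ∀ x, inner ℝ x (A x) = 0) (t : ℝ) : C(Sph n, Sph n) := sphMap (flowIso hA t)

theorem coe_rot (hA : ∀ x, inner ℝ x (A x) = 0) (t : ℝ) (x : Sph n) :
    (rot hA t x : Ambient n) = flow A t x := rfl

theorem rot_zero (hA : ∀ x, inner ℝ x (A x) = 0) (x : Sph n) : rot hA 0 x = x :=
  Subtype.ext (by rw [coe_rot, flow_zero]; rfl)

theorem rot_rot_neg (hA : ∀ x, inner ℝ x (A x) = 0) (t : ℝ) (x : Sph n) :
    rot hA t (rot hA (-t) x) = x := by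
  apply Subtype.ext
  have h := flow_add (A := A) t (-t)
  rw [add_neg_cancel, flow_zero] at h
  rw [coe_rot, coe_rot, ← mul_apply_eq_comp, ← h]
  rfl

theorem rot_neg_rot (hA : ∀ x, inner ℝ x (A x) = 0) (t : ℝ) (x : Sph n) :
    rot hA (-t) (rot hA t x) = x := by
  simpa using rot_rot_neg hA (-t) x

theorem measurePreserving_rot (hA : ∀ x, inner ℝ x (A x) = 0) (t : ℝ) :
    MeasurePreserving (rot hA t) (surf n) (surf n) := measurePreserving_sphMap _

theorem continuous_rot (hA : ∀ x, inner ℝ x (A x) = 0) : Continuous (rot hA) := by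
  apply ContinuousMap.continuous_of_continuous_uncurry
  apply Continuous.subtype_mk
  change Continuous fun p : ℝ × Sph n => flow A p.1 p.2
  exact (continuous_flow.comp continuous_fst).clm_apply (continuous_subtype_val.comp continuous_snd)

theorem measurableEmbedding_rot (hA : ∀ x, inner ℝ x (A x) = 0) (t : ℝ) :
    MeasurableEmbedding (rot hA t) :=
  (Homeomorph.mk ⟨rot hA t, rot hA (-t), rot_neg_rot hA t, rot_rot_neg hA t⟩
    (rot hA t).continuous (rot hA (-t)).continuous).measurableEmbedding

theorem integral_comp_rot_mul (hA : ∀ x, inner ℝ x (A x) = 0) (t : ℝ) (f g : Sph n → ℝ) :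
    ∫ x, f (rot hA t x) * g x ∂(surf n) = ∫ x, f x * g (rot hA (-t) x) ∂(surf n) := by
  rw [← (measurePreserving_rot hA t).integral_comp (measurableEmbedding_rot hA t)
    fun x => f x * g (rot hA (-t) x)]
  exact integral_congr_ae (Filter.Eventually.of_forall fun x => by simp [rot_neg_rot])

/-- Differentiation under the integral along the flow. -/
theorem hasDerivAt_integral_mul_comp_rot (hA : ∀ x, inner ℝ x (A x) = 0) {w : Sph n → ℝ}
    (hw : Integrable w (surf n)) {φ : Ambient n → ℝ} (hφ : ContDiff ℝ 1 φ) (t : ℝ) :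
    HasDerivAt (fun t => ∫ x, w x * φ (rot hA (-t) x) ∂(surf n))
      (-∫ x, w x * fderiv ℝ φ (rot hA (-t) x) (A (rot hA (-t) x)) ∂(surf n)) t := by
  have hcφ : Continuous fun x : Sph n => φ x :=
    hφ.continuous.comp continuous_subtype_val
  have hcD : Continuous fun x : Sph n => fderiv ℝ φ x (A x) :=
    ((hφ.continuous_fderiv one_ne_zero).comp continuous_subtype_val).clm_apply (A.continuous.comp continuous_subtype_val)
  obtain ⟨C, hC⟩ := isCompact_univ.exists_bound_of_continuousOn hcD.continuousOn
  obtain ⟨C₀, hC₀⟩ := isCompact_univ.exists_bound_of_continuousOn hcφ.continuousOn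
  have hmeas : ∀ s, AEStronglyMeasurable (fun x => w x * φ (rot hA (-s) x)) (surf n) := fun s =>
    hw.1.mul (hcφ.comp (rot hA (-s)).continuous).aestronglyMeasurable
  have := (hasDerivAt_integral_of_dominated_loc_of_deriv_le (μ := surf n) (s := Set.univ) (x₀ := t)
    (F := fun s x => w x * φ (rot hA (-s) x))
    (F' := fun s x => w x * -(fderiv ℝ φ (rot hA (-s) x) (A (rot hA (-s) x))))
    (bound := fun x => ‖w x‖ * C) Filter.univ_mem (Filter.Eventually.of_forall hmeas)
    (hw.mul_bdd (c := C₀) (hcφ.comp (rot hA (-t)).continuous).aestronglyMeasurable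
      (Filter.Eventually.of_forall fun x => hC₀ _ trivial))
    (hw.1.mul (hcD.comp (rot hA (-t)).continuous).neg.aestronglyMeasurable)
    (Filter.Eventually.of_forall fun x s _ => by
      rw [norm_mul, norm_neg]
      exact mul_le_mul_of_nonneg_left (hC _ trivial) (norm_nonneg _))
    (hw.norm.mul_const C)
    (Filter.Eventually.of_forall fun x s _ => by
      have h1 : HasDerivAt (fun s => flow A (-s) x) (-(A (flow A (-s) x))) s := by
        have h := (hasDerivAt_flow_apply (A := A) (x : Ambient n) (-s)).scomp s (hasDerivAt_neg s)
        rwa [neg_one_smul] at h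
      have h2 : DifferentiableAt ℝ φ (flow A (-s) x) :=
        (hφ.differentiable one_ne_zero) _
      have h3 := h2.hasFDerivAt.comp_hasDerivAt s h1
      rw [map_neg] at h3
      exact h3.const_mul (w x))).2
  simpa only [mul_neg, integral_neg] using this

/-! ### Test functions, surface divergence and uniqueness of weak gradients. -/

/-- Pushing the surface measure forward to the ambient space reduces this to the fundamental lemma
of the calculus of variations there. -/
theorem ae_eq_zero_of_integral_contDiff_mul_eq_zero {f : Sph n → ℝ} (hf : Integrable f (surf n))
    (h : ∀ φ : Ambient n → ℝ, ContDiff ℝ ∞ φ → ∫ x : Sph n, f x * φ x ∂(surf n) = 0) :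
    ∀ᵐ x ∂(surf n), f x = 0 := by
  have hemb : MeasurableEmbedding ((↑) : Sph n → Ambient n) :=
    isClosed_sphere.isClosedEmbedding_subtypeVal.measurableEmbedding
  have hext : ∀ x : Sph n, Function.extend ((↑) : Sph n → Ambient n) f 0 x = f x := fun x =>
    Subtype.val_injective.extend_apply _ _ _
  have hint : Integrable (Function.extend ((↑) : Sph n → Ambient n) f 0)
      ((surf n).map (↑)) := by
    rw [hemb.integrable_map_iff]
    exact hf.congr (Filter.Eventually.of_forall fun x => (hext x).symm)
  have := ae_eq_zero_of_integral_contDiff_smul_eq_zero hint.locallyIntegrable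
    (fun g hg _ => by
      rw [hemb.integral_map]
      simp only [hext, smul_eq_mul]
      simpa only [mul_comm] using h g hg)
  rw [hemb.ae_map_iff] at this
  simpa only [hext] using this

theorem contMDiff_sphere_restrict {F : Type*} [NormedAddCommGroup F] [NormedSpace ℝ F]
    {W : Ambient n → F} (hW : ContDiff ℝ ∞ W) :
    ContMDiff (𝓡 n) 𝓘(ℝ, F) ∞ fun x : Sph n => W x :=
  have : Fact (Module.finrank ℝ (Ambient n) = n + 1) := ⟨finrank_euclideanSpace_fin⟩
  hW.contMDiff.comp contMDiff_coe_sphere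

theorem hasFDerivAt_normalize (x : Sph n) :
    HasFDerivAt (fun y : Ambient n => ‖y‖⁻¹ • y)
      (ContinuousLinearMap.id ℝ (Ambient n) - (innerSL ℝ (x : Ambient n)).smulRight
        (x : Ambient n)) x := by
  have hx : ‖(x : Ambient n)‖ = 1 := norm_eq_of_mem_sphere x
  have h1 := ((hasStrictFDerivAt_norm_sq (x : Ambient n)).hasFDerivAt.sqrt (by simp [hx]))
  simp only [Real.sqrt_sq (norm_nonneg _)] at h1
  have h2 := (hasDerivAt_inv (by simp [hx] : ‖(x : Ambient n)‖ ≠ 0)).comp_hasFDerivAt _ h1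
  have h3 := h2.fun_smul (hasFDerivAt_id (x : Ambient n))
  refine h3.congr_fderiv ?_
  ext1 v
  simp [hx, two_smul]
  module

theorem trace_eq_zero_of_skew (hA : ∀ x, inner ℝ x (A x) = 0) :
    LinearMap.trace ℝ (Ambient n) A.toLinearMap = 0 := by
  rw [LinearMap.trace_eq_sum_inner _ (EuclideanSpace.basisFun (Fin (n + 1)) ℝ)]
  exact Finset.sum_eq_zero fun i _ => hA _

/-- The surface divergence of `φ A` for a skew-adjoint `A` is the derivative of `φ` along `A`. -/
theorem surfDiv_smul_skew (hA : ∀ x, inner ℝ x (A x) = 0) {φ : Ambient n → ℝ}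
    (hφ : ContDiff ℝ ∞ φ) (x : Sph n) :
    surfDiv (fun x : Sph n => φ x • A x) x = fderiv ℝ φ x (A x) := by
  have hx : ‖(x : Ambient n)‖ = 1 := norm_eq_of_mem_sphere x
  have heq : radialExt (fun x : Sph n => φ x • A x) =ᶠ[nhds (x : Ambient n)]
      (fun y => φ y • A y) ∘ fun y => ‖y‖⁻¹ • y := by
    filter_upwards [isOpen_ne.mem_nhds (ne_zero_of_mem_unit_sphere x)] with y hy
    have hy' : y ≠ 0 := hy
    simp [radialExt, hy', radialProj]
  have hn := hasFDerivAt_normalize x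
  have hW : HasFDerivAt (fun y => φ y • A y)
      (φ x • A + (fderiv ℝ φ x).smulRight (A x)) (‖(x : Ambient n)‖⁻¹ • (x : Ambient n)) := by
    rw [hx, inv_one, one_smul]
    exact ((hφ.differentiable (by simp)) _).hasFDerivAt.fun_smul A.hasFDerivAt
  have h := HasFDerivAt.comp (f := fun y : Ambient n => ‖y‖⁻¹ • y) (x : Ambient n) hW hn
  rw [surfDiv, heq.fderiv_eq, h.fderiv]
  -- The right factor of the composition projects off the radial direction. In the trace this leaves
  -- only `fderiv ℝ φ x (A x)`, since both the trace of `A` and `⟪x, A x⟫` vanish.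
  have hL : (((φ x • A + (fderiv ℝ φ x).smulRight (A x)) ∘L
      (ContinuousLinearMap.id ℝ (Ambient n) - (innerSL ℝ (x : Ambient n)).smulRight
        (x : Ambient n)) : Ambient n →L[ℝ] Ambient n)).toLinearMap
      = φ x • A.toLinearMap + (fderiv ℝ φ x).toLinearMap.smulRight (A x)
        - (innerSL ℝ (x : Ambient n)).toLinearMap.smulRight
          (φ x • A x + fderiv ℝ φ x x • A x) := by
    ext1 v
    simp
    module
  rw [hL, map_sub, map_add, map_smul, trace_eq_zero_of_skew hA, LinearMap.trace_smulRight,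
    LinearMap.trace_smulRight]
  simp [inner_add_right, inner_smul_right, hA]

theorem IsWeakGradient.integral_mul_eq {u : Sph n → ℝ} {Ψ : Sph n → Ambient n}
    (h : IsWeakGradient u Ψ) (hA : ∀ x, inner ℝ x (A x) = 0) {φ : Ambient n → ℝ}
    (hφ : ContDiff ℝ ∞ φ) :
    ∫ x : Sph n, inner ℝ (Ψ x) (A x) * φ x ∂(surf n)
      = -∫ x : Sph n, u x * fderiv ℝ φ x (A x) ∂(surf n) := by
  have := h.integral_eq (fun x : Sph n => φ x • A x)
    ⟨contMDiff_sphere_restrict (hφ.smul A.contDiff),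
      fun x => by rw [inner_smul_right, hA, mul_zero]⟩
  simpa only [surfDiv_smul_skew hA hφ, inner_smul_right, mul_comm] using this

theorem integrable_mul_restrict {f : Sph n → ℝ} (hf : Integrable f (surf n))
    {φ : Ambient n → ℝ} (hφ : Continuous φ) :
    Integrable (fun x => f x * φ x) (surf n) := by
  have hc : Continuous fun x : Sph n => φ x := hφ.comp continuous_subtype_val
  obtain ⟨C, hC⟩ := isCompact_univ.exists_bound_of_continuousOn hc.continuousOn
  exact hf.mul_bdd (c := C) hc.aestronglyMeasurable
    (Filter.Eventually.of_forall fun x => hC x trivial)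

/-- Weak gradients are unique. -/
theorem IsWeakGradient.ae_eq {u : Sph n → ℝ} {Ψ Ψ' : Sph n → Ambient n}
    (h : IsWeakGradient u Ψ) (h' : IsWeakGradient u Ψ') : Ψ =ᵐ[surf n] Ψ' := by
  have key : ∀ i : Fin (n + 1), ∀ᵐ x ∂(surf n), Ψ x i - Ψ' x i = 0 := by
    intro i
    have hi : ∀ {Ψ : Sph n → Ambient n}, Integrable Ψ (surf n) →
        Integrable (fun x => Ψ x i) (surf n) := fun hΨ =>
      (EuclideanSpace.proj (𝕜 := ℝ) i : Ambient n →L[ℝ] ℝ).integrable_comp hΨ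
    refine ae_eq_zero_of_integral_contDiff_mul_eq_zero
      ((hi h.integrable_grad).sub (hi h'.integrable_grad)) fun φ hφ => ?_
    set e : Ambient n := EuclideanSpace.single i 1
    -- On the sphere this is the tangential projection of `φ e`; paired with a tangential field it
    -- isolates the `i`-th coordinate.
    let W : Ambient n → Ambient n := fun y => φ y • (e - (inner ℝ y e : ℝ) • y)
    have hW : IsSmoothTangentField (fun x : Sph n => W x) := by
      refine ⟨contMDiff_sphere_restrict ?_, fun x => ?_⟩
      · exact hφ.smul (contDiff_const.sub ((contDiff_id.inner ℝ contDiff_const).smul contDiff_id))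
      · simp [W, inner_smul_right, inner_sub_right]
    have hgrad : ∀ {Ψ : Sph n → Ambient n}, (∀ᵐ x : Sph n ∂(surf n),
        inner ℝ (x : Ambient n) (Ψ x) = 0) →
        ∫ x, inner ℝ (Ψ x) (W x) ∂(surf n) = ∫ x, Ψ x i * φ x ∂(surf n) := by
      intro Ψ hΨ
      refine integral_congr_ae ?_
      filter_upwards [hΨ] with x hx
      rw [real_inner_comm] at hx
      simp [W, inner_smul_right, inner_sub_right, hx, e, EuclideanSpace.inner_single_right,
        mul_comm]
    have e1 := (h.integral_eq _ hW).trans (h'.integral_eq _ hW).symm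
    rw [hgrad h.tangent, hgrad h'.tangent] at e1
    simp only [sub_mul]
    rw [integral_sub (integrable_mul_restrict (hi h.integrable_grad) hφ.continuous)
      (integrable_mul_restrict (hi h'.integrable_grad) hφ.continuous), e1, sub_self]
  filter_upwards [ae_all_iff.2 key] with x hx
  ext i
  exact sub_eq_zero.1 (hx i)

/-! ### From weak flow derivatives to derivatives in `L^p`. -/

/-- `ψ` is the weak derivative of `u` along the flow generated by `A`. -/
def IsWeakFlowDeriv (A : Ambient n →L[ℝ] Ambient n) (u ψ : Sph n → ℝ) : Prop :=
  ∀ φ : Ambient n → ℝ, ContDiff ℝ ∞ φ →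
    ∫ x : Sph n, ψ x * φ x ∂(surf n) = -∫ x : Sph n, u x * fderiv ℝ φ x (A x) ∂(surf n)

theorem memLp_restrict {p : ENNReal} {φ : Ambient n → ℝ} (hφ : Continuous φ) :
    MemLp (fun x : Sph n => φ x) p (surf n) := by
  have hc : Continuous fun x : Sph n => φ x := hφ.comp continuous_subtype_val
  obtain ⟨C, hC⟩ := isCompact_univ.exists_bound_of_continuousOn hc.continuousOn
  exact MemLp.of_bound hc.aestronglyMeasurable C (Filter.Eventually.of_forall fun x => hC x trivial)

section Lp

variable {p q : ENNReal} [Fact (1 ≤ p)] [Fact (1 ≤ q)] [p.HolderConjugate q]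

/-- The pairing `f ↦ ∫ f w` on `L^p` with a fixed `w ∈ L^q`. -/
def pairing (p : ENNReal) [Fact (1 ≤ p)] [p.HolderConjugate q] {w : Sph n → ℝ}
    (hw : MemLp w q (surf n)) : Lp ℝ p (surf n) →L[ℝ] ℝ :=
  ((ContinuousLinearMap.mul ℝ ℝ).lpPairing (surf n) p q).flip hw.toLp

theorem pairing_eq {w : Sph n → ℝ} (hw : MemLp w q (surf n)) {f : Lp ℝ p (surf n)}
    {g : Sph n → ℝ} (hfg : f =ᵐ[surf n] g) :
    pairing p hw f = ∫ x, g x * w x ∂(surf n) := by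
  rw [pairing, ContinuousLinearMap.flip_apply, ContinuousLinearMap.lpPairing_eq_integral]
  refine integral_congr_ae ?_
  filter_upwards [hfg, hw.coeFn_toLp] with x h1 h2
  simp [h1, h2]

variable {u ψ : Sph n → ℝ}

/-- A weak derivative in `L^p` along a rotation flow is a derivative of translations in `L^p`. -/
theorem hasDerivAt_toLp_comp_rot (q : ENNReal) [Fact (1 ≤ q)] [p.HolderConjugate q]
    (hp : p ≠ ⊤) (hA : ∀ x, inner ℝ x (A x) = 0)
    (hu : MemLp u p (surf n)) (hψ : MemLp ψ p (surf n)) (h : IsWeakFlowDeriv A u ψ) :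
    HasDerivAt (fun t => Lp.compMeasurePreserving (rot hA t) (measurePreserving_rot hA t) hu.toLp)
      hψ.toLp 0 := by
  set U : ℝ → Lp ℝ p (surf n) := fun t =>
    Lp.compMeasurePreserving (rot hA t) (measurePreserving_rot hA t) hu.toLp with hU
  set P : ℝ → Lp ℝ p (surf n) := fun t =>
    Lp.compMeasurePreserving (rot hA t) (measurePreserving_rot hA t) hψ.toLp with hP
  have hcoe : ∀ {f : Sph n → ℝ} (hf : MemLp f p (surf n)) (t : ℝ),
      (Lp.compMeasurePreserving (rot hA t) (measurePreserving_rot hA t) hf.toLp : Sph n → ℝ)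
        =ᵐ[surf n] fun x => f (rot hA t x) := fun hf t => by
    rw [Lp.toLp_compMeasurePreserving]
    exact MemLp.coeFn_toLp _
  have hPc : Continuous P :=
    continuous_const.compMeasurePreservingLp (continuous_rot hA) (measurePreserving_rot hA) hp
  have hP0 : P 0 = hψ.toLp := by
    apply Lp.ext
    filter_upwards [hcoe hψ 0, hψ.coeFn_toLp] with x h1 h2
    rw [h1, h2, rot_zero]
  -- The identity `U t = U 0 + ∫ P` is checked against smooth `φ`. Moving the rotation onto `φ`
  -- makes each pairing differentiable although `U` is not yet known to be.
  have hpair : ∀ φ : Ambient n → ℝ, ContDiff ℝ ∞ φ → ∀ t : ℝ,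
      ∫ x : Sph n, (U t - U 0 - ∫ s in (0 : ℝ)..t, P s : Lp ℝ p (surf n)) x * φ x ∂(surf n)
        = 0 := by
    intro φ hφ t
    have hw : MemLp (fun x : Sph n => φ x) q (surf n) := memLp_restrict hφ.continuous
    rw [← pairing_eq hw (Filter.EventuallyEq.refl _ _), map_sub, map_sub,
      ← ContinuousLinearMap.intervalIntegral_comp_comm _ (hPc.intervalIntegrable _ _),
      intervalIntegral.integral_eq_sub_of_hasDerivAt (f := fun s => pairing p hw (U s)), sub_self]
    · intro s _
      have h1 := hasDerivAt_integral_mul_comp_rot hA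
        (hu.integrable Fact.out) (hφ.of_le (by simp) : ContDiff ℝ 1 φ) s
      have h2 : (fun s => pairing p hw (U s))
          = fun t => ∫ x, u x * φ (rot hA (-t) x) ∂(surf n) := by
        ext t
        rw [pairing_eq hw (hcoe hu t), integral_comp_rot_mul hA t u (fun x => φ x)]
      have h3 : pairing p hw (P s) = -∫ x, u x *
          fderiv ℝ φ (rot hA (-s) x) (A (rot hA (-s) x)) ∂(surf n) := by
        rw [pairing_eq hw (hcoe hψ s), integral_comp_rot_mul hA s ψ (fun x => φ x)]
        -- The weak derivative is tested with the rotated function; `A` commutes with its own flow,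
        -- so the derivative of `φ` reappears at the rotated point.
        have h4 := h (fun y => φ (flow A (-s) y)) (hφ.comp (flow A (-s)).contDiff)
        simp only [coe_rot]
        rw [h4]
        congr 2
        ext x
        congr 1
        have h5 := ((hφ.differentiable (by simp)) (flow A (-s) x)).hasFDerivAt.comp (x : Ambient n)
          (flow A (-s)).hasFDerivAt
        have h6 : fderiv ℝ (fun y => φ (flow A (-s) y)) x
          = (fderiv ℝ φ (flow A (-s) x)).comp (flow A (-s)) := h5.fderiv
        rw [h6, ContinuousLinearMap.comp_apply, flow_apply_comm]
      rw [h2, h3]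
      exact h1
    · exact ((pairing p hw).continuous.comp hPc).intervalIntegrable _ _
  have hW : ∀ t, U t = U 0 + ∫ s in (0 : ℝ)..t, P s := by
    intro t
    rw [← sub_eq_iff_eq_add', ← sub_eq_zero]
    apply Lp.ext
    filter_upwards [ae_eq_zero_of_integral_contDiff_mul_eq_zero
      ((Lp.memLp _).integrable Fact.out) fun φ hφ => hpair φ hφ t,
      Lp.coeFn_zero ℝ p (surf n)] with x h1 h2
    rw [h1, h2, Pi.zero_apply]
  have hd := intervalIntegral.integral_hasDerivAt_right (hPc.intervalIntegrable 0 0)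
    (hPc.stronglyMeasurableAtFilter _ _) hPc.continuousAt
  rw [hP0] at hd
  have hd' := hd.const_add (U 0)
  rwa [← funext hW] at hd'

theorem hasDerivAt_integral_comp_rot_mul (hp : p ≠ ⊤) (hA : ∀ x, inner ℝ x (A x) = 0)
    (hu : MemLp u p (surf n)) (hψ : MemLp ψ p (surf n)) (h : IsWeakFlowDeriv A u ψ)
    {w : Sph n → ℝ} (hw : MemLp w q (surf n)) :
    HasDerivAt (fun t => ∫ x, u (rot hA t x) * w x ∂(surf n)) (∫ x, ψ x * w x ∂(surf n)) 0 := by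
  have h1 := (pairing p hw).hasFDerivAt.comp_hasDerivAt 0
    (hasDerivAt_toLp_comp_rot q hp hA hu hψ h)
  rw [pairing_eq hw hψ.coeFn_toLp] at h1
  refine h1.congr_of_eventuallyEq (Filter.Eventually.of_forall fun t => ?_)
  refine (pairing_eq hw ?_).symm
  beta_reduce
  rw [Lp.toLp_compMeasurePreserving]
  exact MemLp.coeFn_toLp _

end Lp

/-! ### The chain rule for `|u| ^ n`. -/

/-- Young's inequality with natural exponents. -/
theorem young_pow (hn : 1 ≤ n) {a b : ℝ} (ha : 0 ≤ a) (hb : 0 ≤ b) :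
    n * (b ^ (n - 1) * a) ≤ a ^ n + (n - 1) * b ^ n := by
  obtain ⟨m, rfl⟩ : ∃ m, n = m + 1 := ⟨n - 1, by omega⟩
  rcases hb.eq_or_lt with rfl | hb
  · rcases m with _ | m
    · simp
    · simp; positivity
  have h := one_add_mul_le_pow (a := a / b - 1) (by linarith [div_nonneg ha hb.le]) (m + 1)
  have h2 := mul_le_mul_of_nonneg_right h (pow_pos hb (m + 1)).le
  rw [add_sub_cancel, ← mul_pow, div_mul_cancel₀ _ hb.ne'] at h2
  have h3 : (1 + ((m + 1 : ℕ) : ℝ) * (a / b - 1)) * b ^ (m + 1)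
      = (m + 1 : ℕ) * (b ^ m * a) - ((m + 1 : ℕ) - 1) * b ^ (m + 1) := by
    field_simp
    push_cast
    ring
  rw [h3] at h2
  rw [Nat.add_sub_cancel]
  linarith

/-- The tangent line inequality for the convex function `|a| ^ n`. -/
theorem abs_pow_tangent (hn : 2 ≤ n) (a b : ℝ) :
    |a| ^ n + n * (|a| ^ (n - 2) * a) * (b - a) ≤ |b| ^ n := by
  have h := young_pow (by omega : 1 ≤ n) (abs_nonneg b) (abs_nonneg a)
  obtain ⟨m, rfl⟩ : ∃ m, n = m + 2 := ⟨n - 2, by omega⟩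
  have h1 : |a| ^ m * (a * b) ≤ |a| ^ m * (|a| * |b|) :=
    mul_le_mul_of_nonneg_left ((le_abs_self _).trans (abs_mul a b).le) (by positivity)
  have h2 : |a| ^ (m + 2) = |a| ^ m * (a * a) := by rw [pow_add, sq_abs, sq]
  simp only [Nat.add_sub_cancel, show m + 2 - 1 = m + 1 by omega] at *
  have h3 : |a| ^ (m + 1) * |b| = |a| ^ m * (|a| * |b|) := by ring
  rw [h3, h2] at h
  have h4 := mul_le_mul_of_nonneg_left h1 (Nat.cast_nonneg (α := ℝ) (m + 2))
  rw [h2]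
  nlinarith

theorem memLp_abs_pow_mul (hn : 2 ≤ n) {u : Sph n → ℝ} (hu : MemLp u n (surf n)) :
    MemLp (fun x => |u x| ^ (n - 2) * u x) ((n : ENNReal) / ((n - 1 : ℕ) : ENNReal)) (surf n) := by
  have h := hu.norm_rpow_div ((n - 1 : ℕ) : ENNReal)
  have hm : AEStronglyMeasurable (fun x => |u x| ^ (n - 2) * u x) (surf n) :=
    ((continuous_abs.comp_aestronglyMeasurable hu.1).pow _).mul hu.1
  refine h.congr_norm hm (Filter.Eventually.of_forall fun x => ?_)
  simp only [Real.norm_eq_abs, ENNReal.toReal_natCast, Real.rpow_natCast, abs_mul, abs_pow, abs_abs]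
  rw [← pow_succ]
  congr 1
  omega

theorem holderConjugate_nat (hn : 2 ≤ n) :
    (n : ENNReal).HolderConjugate ((n : ENNReal) / ((n - 1 : ℕ) : ENNReal)) := by
  rw [ENNReal.holderConjugate_iff, ENNReal.inv_div (by simp) (by simp; omega), ← one_div,
    ENNReal.div_add_div_same]
  have : (1 : ENNReal) + ((n - 1 : ℕ) : ENNReal) = n := by
    rw [← Nat.cast_one, ← Nat.cast_add]
    congr 1
    omega
  rw [this]
  exact ENNReal.div_self (by simp; omega) (by simp)

theorem integrable_abs_pow (hn : n ≠ 0) {u : Sph n → ℝ} (hu : MemLp u n (surf n)) :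
    Integrable (fun x => |u x| ^ n) (surf n) := hu.integrable_norm_pow hn

theorem memLp_abs_pow_mul_restrict (hn : 2 ≤ n) {u : Sph n → ℝ} (hu : MemLp u n (surf n))
    {φ : Ambient n → ℝ} (hφ : Continuous φ) :
    MemLp (fun x : Sph n => n * (|u x| ^ (n - 2) * u x) * φ x)
      ((n : ENNReal) / ((n - 1 : ℕ) : ENNReal)) (surf n) :=
  (((memLp_abs_pow_mul hn hu).const_mul (n : ℝ)).mul (memLp_restrict (p := ⊤) hφ)).ae_eq
    (Filter.Eventually.of_forall fun _ => mul_comm _ _)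

theorem integrable_mul_abs_pow_mul (hn : 2 ≤ n) {f u : Sph n → ℝ} (hf : MemLp f n (surf n))
    (hu : MemLp u n (surf n)) {φ : Ambient n → ℝ} (hφ : Continuous φ) :
    Integrable (fun x : Sph n => f x * (n * (|u x| ^ (n - 2) * u x) * φ x)) (surf n) :=
  have := holderConjugate_nat hn
  memLp_one_iff_integrable.1 ((memLp_abs_pow_mul_restrict hn hu hφ).mul hf)

/-- The chain rule for `|u| ^ n` along a rotation flow. -/
theorem integral_abs_pow_mul_fderiv (hn : 2 ≤ n) (hA : ∀ x, inner ℝ x (A x) = 0)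
    {u ψ : Sph n → ℝ} (hu : MemLp u n (surf n)) (hψ : MemLp ψ n (surf n))
    (h : IsWeakFlowDeriv A u ψ) {φ : Ambient n → ℝ} (hφ : ContDiff ℝ 1 φ) :
    ∫ x : Sph n, |u x| ^ n * fderiv ℝ φ x (A x) ∂(surf n)
      = -∫ x : Sph n, ψ x * (n * (|u x| ^ (n - 2) * u x) * φ x) ∂(surf n) := by
  have : Fact (1 ≤ (n : ENNReal)) := ⟨by exact_mod_cast (by omega : 1 ≤ n)⟩
  have hpq := holderConjugate_nat hn
  have : Fact (1 ≤ (n : ENNReal) / ((n - 1 : ℕ) : ENNReal)) :=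
    ⟨ENNReal.HolderConjugate.one_le _ (n : ENNReal)⟩
  have hint := integrable_abs_pow (by omega) hu
  have key : ∀ φ : Ambient n → ℝ, ContDiff ℝ 1 φ → (∀ x : Sph n, 0 ≤ φ x) →
      ∫ x : Sph n, |u x| ^ n * fderiv ℝ φ x (A x) ∂(surf n)
        = -∫ x : Sph n, ψ x * (n * (|u x| ^ (n - 2) * u x) * φ x) ∂(surf n) := by
    intro φ hφ hφ0
    have h1 := hasDerivAt_integral_mul_comp_rot hA hint hφ 0
    have h2 := hasDerivAt_integral_comp_rot_mul (by simp) hA hu hψ h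
      (memLp_abs_pow_mul_restrict hn hu hφ.continuous)
    have h3 := h1.sub h2
    simp only [neg_zero, rot_zero] at h3
    -- For `φ ≥ 0` the tangent line inequality between `u` and its rotation, multiplied by `φ` and
    -- integrated, puts the minimum at `t = 0`. The vanishing derivative there is the claimed
    -- equality, obtained from a one-sided estimate.
    have hmin : IsLocalMin ((fun t => ∫ x, |u x| ^ n * φ (rot hA (-t) x) ∂(surf n))
        - fun t => ∫ x, u (rot hA t x) * (n * (|u x| ^ (n - 2) * u x) * φ x) ∂(surf n)) 0 := by
      refine Filter.Eventually.of_forall fun t => ?_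
      have i1 : Integrable (fun x => |u (rot hA t x)| ^ n * φ x) (surf n) :=
        integrable_mul_restrict ((measurePreserving_rot hA t).integrable_comp_of_integrable hint)
          hφ.continuous
      have i3 : Integrable (fun x => u (rot hA t x) * (n * (|u x| ^ (n - 2) * u x) * φ x))
          (surf n) :=
        integrable_mul_abs_pow_mul hn (hu.comp_measurePreserving (measurePreserving_rot hA t)) hu
          hφ.continuous
      have i4 := integrable_mul_abs_pow_mul hn hu hu hφ.continuous
      simp only [Pi.sub_apply, neg_zero, rot_zero]
      rw [← integral_comp_rot_mul hA t (fun x => |u x| ^ n) (fun x => φ x), ← integral_sub i1 i3,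
        ← integral_sub (integrable_mul_restrict hint hφ.continuous) i4]
      refine integral_mono ((integrable_mul_restrict hint hφ.continuous).sub i4) (i1.sub i3)
        fun x => ?_
      have := mul_le_mul_of_nonneg_right (abs_pow_tangent hn (u x) (u (rot hA t x))) (hφ0 x)
      linarith
    have := hmin.hasDerivAt_eq_zero h3
    linarith
  -- The sign condition is removed by writing `φ = (φ + C) - C` with both pieces nonnegative on the
  -- sphere.
  obtain ⟨C, hC⟩ := isCompact_univ.exists_bound_of_continuousOn
    (hφ.continuous.comp (continuous_subtype_val (p := (· ∈ sphere (0 : Ambient n) 1)))).continuousOn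
  have k1 := key (fun y => φ y + C) (hφ.add contDiff_const) fun x => by
    have := neg_le_of_abs_le (hC x trivial)
    simp only [Function.comp_apply] at this
    linarith
  have k2 := key (fun _ => C) contDiff_const fun x => (norm_nonneg _).trans (hC x trivial)
  have i1 := integrable_mul_abs_pow_mul hn hψ hu hφ.continuous
  have i2 := integrable_mul_abs_pow_mul hn hψ hu (continuous_const (y := C))
  simp only [fderiv_add_const, mul_add] at k1
  rw [integral_add i1 i2] at k1
  simp only [fderiv_fun_const, Pi.zero_apply, zero_apply, mul_zero,
    integral_zero] at k2
  rw [k1]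
  linarith

/-! ### Integration by parts against zonal fields. -/

/-- The skew-adjoint map `y ↦ ⟪v, y⟫ p - ⟪p, y⟫ v`. -/
def skewGen (p v : Ambient n) : Ambient n →L[ℝ] Ambient n :=
  (innerSL ℝ v).smulRight p - (innerSL ℝ p).smulRight v

theorem skewGen_apply (p v y : Ambient n) :
    skewGen p v y = (inner ℝ v y : ℝ) • p - (inner ℝ p y : ℝ) • v := by simp [skewGen]

theorem inner_skewGen (p v y : Ambient n) : inner ℝ y (skewGen p v y) = (0 : ℝ) := by
  rw [skewGen_apply, inner_sub_right, inner_smul_right, inner_smul_right, real_inner_comm p y,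
    real_inner_comm v y]
  ring

theorem memLp_inner_clm {p : ENNReal} {Ψ : Sph n → Ambient n} (hΨ : MemLp Ψ p (surf n))
    (A : Ambient n →L[ℝ] Ambient n) : MemLp (fun x => inner ℝ (Ψ x) (A x)) p (surf n) := by
  refine hΨ.of_le_mul (c := ‖A‖)
    (hΨ.1.inner (A.continuous.comp continuous_subtype_val).aestronglyMeasurable)
    (Filter.Eventually.of_forall fun x => ?_)
  refine (norm_inner_le_norm _ _).trans ?_
  rw [mul_comm]
  gcongr
  simpa using A.le_opNorm x

/-- The integration by parts identity for `|u| ^ n` against the zonal field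
`h(⟪x, Φ⟫) (Φ - ⟪x, Φ⟫ x)`. -/
theorem integral_abs_pow_mul_zonal (hn : 2 ≤ n) (Φ : Sph n) {u : Sph n → ℝ}
    {Ψ : Sph n → Ambient n} (hu : MemLp u n (surf n)) (hΨ : MemLp Ψ n (surf n))
    (hw : IsWeakGradient u Ψ) {h : ℝ → ℝ} (hh : ContDiff ℝ 1 h) :
    Integrable (fun x : Sph n => |u x| ^ n * ((1 - (inner ℝ (x : Ambient n) Φ : ℝ) ^ 2)
        * deriv h (inner ℝ (x : Ambient n) Φ)
        - n * inner ℝ (x : Ambient n) Φ * h (inner ℝ (x : Ambient n) Φ))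
      + n * (|u x| ^ (n - 2) * u x) * h (inner ℝ (x : Ambient n) Φ)
        * inner ℝ (Ψ x) ((Φ : Ambient n) - (inner ℝ (x : Ambient n) Φ : ℝ) • (x : Ambient n)))
      (surf n) ∧
    ∫ x : Sph n, (|u x| ^ n * ((1 - (inner ℝ (x : Ambient n) Φ : ℝ) ^ 2)
        * deriv h (inner ℝ (x : Ambient n) Φ)
        - n * inner ℝ (x : Ambient n) Φ * h (inner ℝ (x : Ambient n) Φ))
      + n * (|u x| ^ (n - 2) * u x) * h (inner ℝ (x : Ambient n) Φ)
        * inner ℝ (Ψ x) ((Φ : Ambient n) - (inner ℝ (x : Ambient n) Φ : ℝ) • (x : Ambient n)))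
      ∂(surf n) = 0 := by
  let e : Fin (n + 1) → Ambient n := fun i => EuclideanSpace.single i 1
  -- On the sphere `∑ i, φ i • A i = h(c) (Φ - c x)`, because `∑ i, x i • (x i • Φ - c • e i) = Φ -
  -- c • x`.
  let A : Fin (n + 1) → Ambient n →L[ℝ] Ambient n := fun i => skewGen Φ (e i)
  let φ : Fin (n + 1) → Ambient n → ℝ := fun i y => h (inner ℝ y Φ) * inner ℝ (e i) y
  have hφ : ∀ i, ContDiff ℝ 1 (φ i) := fun i =>
    (hh.comp (contDiff_id.inner ℝ contDiff_const)).mul (contDiff_const.inner ℝ contDiff_id)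
  have hA : ∀ i x, inner ℝ x (A i x) = (0 : ℝ) := fun i x => inner_skewGen _ _ _
  have hei : ∀ i (y : Ambient n), (inner ℝ (e i) y : ℝ) = y i := fun i y => by
    simp [e, EuclideanSpace.inner_single_left]
  have hint := integrable_abs_pow (by omega) hu
  have i1 : ∀ i, Integrable (fun x : Sph n => |u x| ^ n * fderiv ℝ (φ i) x (A i x)) (surf n) :=
    fun i => integrable_mul_restrict hint
      (((hφ i).continuous_fderiv one_ne_zero).clm_apply (A i).continuous)
  have i2 : ∀ i, Integrable (fun x : Sph n => inner ℝ (Ψ x) (A i x)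
      * (n * (|u x| ^ (n - 2) * u x) * φ i x)) (surf n) := fun i =>
    integrable_mul_abs_pow_mul hn (memLp_inner_clm hΨ (A i)) hu (hφ i).continuous
  have hpt : ∀ x : Sph n, |u x| ^ n * ((1 - (inner ℝ (x : Ambient n) Φ : ℝ) ^ 2)
        * deriv h (inner ℝ (x : Ambient n) Φ)
        - n * inner ℝ (x : Ambient n) Φ * h (inner ℝ (x : Ambient n) Φ))
      + n * (|u x| ^ (n - 2) * u x) * h (inner ℝ (x : Ambient n) Φ)
        * inner ℝ (Ψ x) ((Φ : Ambient n) - (inner ℝ (x : Ambient n) Φ : ℝ) • (x : Ambient n))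
      = ∑ i, (|u x| ^ n * fderiv ℝ (φ i) x (A i x)
        + inner ℝ (Ψ x) (A i x) * (n * (|u x| ^ (n - 2) * u x) * φ i x)) := by
    intro x
    have hs1 : ∑ i, (x : Ambient n) i * (x : Ambient n) i = 1 := by
      have := EuclideanSpace.real_norm_sq_eq (x : Ambient n)
      rw [norm_eq_of_mem_sphere x] at this
      simpa [sq] using this.symm
    have hs2 : ∑ i, (x : Ambient n) i * (Φ : Ambient n) i = inner ℝ (x : Ambient n) Φ := by
      simp [PiLp.inner_apply, mul_comm]
    have hs3 : ∑ i, (x : Ambient n) i * Ψ x i = inner ℝ (Ψ x) x := by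
      simp [PiLp.inner_apply]
    set c : ℝ := inner ℝ (x : Ambient n) Φ with hc
    have hder : ∀ i, fderiv ℝ (φ i) x (A i x)
        = h c * ((x : Ambient n) i * (Φ : Ambient n) i - c)
          + deriv h c * ((x : Ambient n) i * (x : Ambient n) i
            - c * ((x : Ambient n) i * (Φ : Ambient n) i)) := by
      intro i
      have d1 : HasFDerivAt (fun y : Ambient n => (inner ℝ y Φ : ℝ)) (innerSL ℝ (Φ : Ambient n))
          x := by
        have : (fun y : Ambient n => (inner ℝ y Φ : ℝ)) = innerSL ℝ (Φ : Ambient n) :=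
          funext fun y => real_inner_comm _ _
        rw [this]
        exact (innerSL ℝ (Φ : Ambient n)).hasFDerivAt
      have d2 : HasFDerivAt (fun y : Ambient n => (inner ℝ (e i) y : ℝ)) (innerSL ℝ (e i)) x :=
        (innerSL ℝ (e i)).hasFDerivAt
      have d3 : HasDerivAt h (deriv h c) c := (hh.differentiable one_ne_zero c).hasDerivAt
      have d4 := (d3.comp_hasFDerivAt (x : Ambient n) d1).mul d2
      have d5 : fderiv ℝ (φ i) x = _ := d4.fderiv
      rw [d5]
      have hei1 : (e i) i = 1 := by simp [e]
      have hci : (inner ℝ (Φ : Ambient n) x : ℝ) = c := real_inner_comm _ _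
      have hΦe : (inner ℝ (Φ : Ambient n) (e i) : ℝ) = (Φ : Ambient n) i := by
        rw [real_inner_comm, hei]
      simp [A, skewGen_apply, inner_sub_right, inner_smul_right, hei, ← hc, hei1, hci, hΦe]
      ring
    have hψ : ∀ i, (inner ℝ (Ψ x) (A i x) : ℝ)
        = (x : Ambient n) i * inner ℝ (Ψ x) Φ - c * Ψ x i := by
      intro i
      simp only [A, skewGen_apply, inner_sub_right, inner_smul_right, hei]
      rw [real_inner_comm (e i), hei, real_inner_comm (x : Ambient n), ← hc]
    have hφx : ∀ i, φ i x = h c * (x : Ambient n) i := fun i => by simp only [φ, hei, ← hc]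
    simp only [hder, hψ, hφx, Finset.sum_add_distrib, ← Finset.mul_sum, Finset.sum_sub_distrib,
      hs1, hs2]
    have hlast : ∑ i, ((x : Ambient n) i * inner ℝ (Ψ x) Φ - c * Ψ x i)
        * (n * (|u x| ^ (n - 2) * u x) * (h c * (x : Ambient n) i))
        = n * (|u x| ^ (n - 2) * u x) * h c * (inner ℝ (Ψ x) Φ - c * inner ℝ (Ψ x) x) := by
      have : ∀ i, ((x : Ambient n) i * inner ℝ (Ψ x) Φ - c * Ψ x i)
          * (n * (|u x| ^ (n - 2) * u x) * (h c * (x : Ambient n) i))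
          = n * (|u x| ^ (n - 2) * u x) * h c * (inner ℝ (Ψ x) Φ *
            ((x : Ambient n) i * (x : Ambient n) i) - c * ((x : Ambient n) i * Ψ x i)) :=
        fun i => by ring
      simp only [this, ← Finset.mul_sum, Finset.sum_sub_distrib, hs1, hs3, mul_one]
    rw [hlast, inner_sub_right, inner_smul_right]
    simp only [Finset.sum_const, Finset.card_univ, Fintype.card_fin, nsmul_eq_mul]
    push_cast
    ring
  simp only [hpt]
  have i3 : ∀ i ∈ Finset.univ, Integrable (fun x : Sph n => |u x| ^ n * fderiv ℝ (φ i) x (A i x)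
      + inner ℝ (Ψ x) (A i x) * (n * (|u x| ^ (n - 2) * u x) * φ i x)) (surf n) :=
    fun i _ => (i1 i).add (i2 i)
  refine ⟨integrable_finsetSum _ i3, ?_⟩
  rw [integral_finsetSum _ i3]
  refine Finset.sum_eq_zero fun i _ => ?_
  rw [integral_add (i1 i) (i2 i), integral_abs_pow_mul_fderiv hn (hA i) hu
    (memLp_inner_clm hΨ (A i)) (fun f hf => hw.integral_mul_eq (hA i) hf) (hφ i)]
  ring

/-! ### The cutoff, the weights and the radial profile. -/

/-- A smooth cutoff of `c ∈ [-1, 1]` vanishing near the poles `c = ±1`. -/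
def cut (k : ℕ) (c : ℝ) : ℝ := Real.smoothTransition (k * (1 - c ^ 2) - 1)

/-- The sine of the geodesic distance as a function of its cosine. -/
def sinC (c : ℝ) : ℝ := √(1 - c ^ 2)

/-- The logarithmic weight as a function of the cosine of the geodesic distance. -/
def logC (c : ℝ) : ℝ := Real.log (Real.exp 1 / sinC c)

/-- The radial profile of the test field. -/
def profile (n k : ℕ) (m : ℝ → ℝ) (c : ℝ) : ℝ :=
  -(cut k c * m c / (sinC c ^ n * logC c ^ (n - 1)))

theorem cut_nonneg (k : ℕ) (c : ℝ) : 0 ≤ cut k c := Real.smoothTransition.nonneg _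

theorem cut_le_one (k : ℕ) (c : ℝ) : cut k c ≤ 1 := Real.smoothTransition.le_one _

theorem continuous_cut (k : ℕ) : Continuous (cut k) :=
  Real.smoothTransition.continuous.comp (by fun_prop)

theorem cut_eq_zero {k : ℕ} {c : ℝ} (h : k * (1 - c ^ 2) ≤ 1) : cut k c = 0 :=
  Real.smoothTransition.zero_of_nonpos (by linarith)

theorem cut_eventually_eq_one {c : ℝ} (hc : 0 < 1 - c ^ 2) :
    ∀ᶠ k : ℕ in Filter.atTop, cut k c = 1 := by
  obtain ⟨N, hN⟩ := exists_nat_gt (2 / (1 - c ^ 2))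
  filter_upwards [Filter.eventually_ge_atTop N] with k hk
  refine Real.smoothTransition.one_of_one_le ?_
  have h1 : 2 / (1 - c ^ 2) ≤ k := hN.le.trans (by exact_mod_cast hk)
  rw [div_le_iff₀ hc] at h1
  linarith

theorem sinC_nonneg (c : ℝ) : 0 ≤ sinC c := Real.sqrt_nonneg _

theorem sinC_le_one (c : ℝ) : sinC c ≤ 1 := Real.sqrt_le_one.2 (by nlinarith [sq_nonneg c])

theorem sinC_pos {c : ℝ} (hc : 0 < 1 - c ^ 2) : 0 < sinC c := Real.sqrt_pos.2 hc

theorem sinC_eq_zero {c : ℝ} (hc : 1 - c ^ 2 ≤ 0) : sinC c = 0 := Real.sqrt_eq_zero_of_nonpos hc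

theorem sq_sinC {c : ℝ} (hc : 0 ≤ 1 - c ^ 2) : sinC c ^ 2 = 1 - c ^ 2 := Real.sq_sqrt hc

theorem logC_eq {c : ℝ} (hc : 0 < 1 - c ^ 2) : logC c = 1 - Real.log (sinC c) := by
  rw [logC, Real.log_div (Real.exp_pos _).ne' (sinC_pos hc).ne', Real.log_exp]

theorem logC_of_nonpos {c : ℝ} (hc : 1 - c ^ 2 ≤ 0) : logC c = 0 := by
  rw [logC, sinC_eq_zero hc, div_zero, Real.log_zero]

theorem one_le_logC {c : ℝ} (hc : 0 < 1 - c ^ 2) : 1 ≤ logC c := by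
  rw [logC_eq hc]
  linarith [Real.log_nonpos (sinC_nonneg c) (sinC_le_one c)]

theorem logC_nonneg (c : ℝ) : 0 ≤ logC c := by
  rcases lt_or_ge 0 (1 - c ^ 2) with hc | hc
  · exact zero_le_one.trans (one_le_logC hc)
  · exact (logC_of_nonpos hc).ge

theorem sinC_mul_logC_le_one {c : ℝ} (hc : 0 < 1 - c ^ 2) : sinC c * logC c ≤ 1 := by
  have hs := sinC_pos hc
  have h := Real.log_le_sub_one_of_pos (inv_pos.2 hs)
  rw [Real.log_inv] at h
  have h2 : logC c ≤ (sinC c)⁻¹ := by rw [logC_eq hc]; linarith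
  calc sinC c * logC c ≤ sinC c * (sinC c)⁻¹ := by gcongr
    _ = 1 := mul_inv_cancel₀ hs.ne'

/-- The cutoff vanishes wherever `k (1 - c ^ 2) ≤ 1`, which contains a neighbourhood of each `c`
with `|c| ≥ 1`. This makes the profile `C^1` on the whole line despite the singular weights. -/
theorem profile_eventually_eq_zero (k : ℕ) (m : ℝ → ℝ) {c : ℝ} (hc : 1 - c ^ 2 ≤ 0) :
    profile n k m =ᶠ[nhds c] fun _ => 0 := by
  have hopen : ∀ᶠ c' in nhds c, (k : ℝ) * (1 - c' ^ 2) < 1 := by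
    have : Continuous fun c' : ℝ => (k : ℝ) * (1 - c' ^ 2) := by fun_prop
    exact this.continuousAt.eventually_lt continuousAt_const
      (lt_of_le_of_lt (mul_nonpos_of_nonneg_of_nonpos (Nat.cast_nonneg k) hc) one_pos)
  filter_upwards [hopen] with c' hc'
  simp [profile, cut_eq_zero hc'.le]

theorem contDiff_profile (k : ℕ) {m : ℝ → ℝ} (hm : ContDiff ℝ 1 m) :
    ContDiff ℝ 1 (profile n k m) := by
  rw [contDiff_iff_contDiffAt]
  intro c
  rcases lt_or_ge 0 (1 - c ^ 2) with hc | hc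
  · have hs := sinC_pos hc
    have hL := one_le_logC hc
    have h1 : ContDiffAt ℝ 1 sinC c :=
      (contDiffAt_const.sub (contDiffAt_id.pow 2)).sqrt hc.ne'
    have h2 : ContDiffAt ℝ 1 logC c :=
      (contDiffAt_const.div h1 hs.ne').log (div_pos (Real.exp_pos _) hs).ne'
    have h3 : ContDiffAt ℝ 1 (cut k) c := by
      have : ContDiff ℝ 1 (cut k) := (Real.smoothTransition.contDiff (n := 1)).comp
        ((contDiff_const.mul (contDiff_const.sub (contDiff_id.pow 2))).sub contDiff_const)
      exact this.contDiffAt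
    exact ((h3.mul hm.contDiffAt).div ((h1.pow n).mul (h2.pow (n - 1)))
      (mul_pos (pow_pos hs _) (pow_pos (by linarith) _)).ne').neg
  · exact contDiffAt_const.congr_of_eventuallyEq (profile_eventually_eq_zero k m hc)

/-- The lower bound for the divergence of the test field. -/
theorem le_div_profile (hn : 2 ≤ n) (k : ℕ) {m m' : ℝ → ℝ} (hm : ∀ c, HasDerivAt m (m' c) c)
    (hcm : ∀ c, 0 ≤ c * m c) (c : ℝ) :
    cut k c * ((n - 1) * (c * m c) / (sinC c ^ n * logC c ^ n)
        - m' c / (sinC c ^ (n - 2) * logC c ^ (n - 1)))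
      ≤ (1 - c ^ 2) * deriv (profile n k m) c - n * c * profile n k m c := by
  rcases lt_or_ge 0 (1 - c ^ 2) with hc | hc
  swap
  · have h1 := profile_eventually_eq_zero (n := n) k m hc
    have h2 : (k : ℝ) * (1 - c ^ 2) ≤ 1 :=
      (mul_nonpos_of_nonneg_of_nonpos (Nat.cast_nonneg k) hc).trans zero_le_one
    rw [h1.deriv_eq, h1.eq_of_nhds, cut_eq_zero h2]
    simp
  have hs := sinC_pos hc
  have hL : 0 < logC c := zero_lt_one.trans_le (one_le_logC hc)
  have hsq := sq_sinC hc.le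
  set ρ : ℝ := deriv Real.smoothTransition (k * (1 - c ^ 2) - 1) with hρ
  have hρ0 : 0 ≤ ρ := Real.smoothTransition.monotone.deriv_nonneg
  have dcut : HasDerivAt (cut k) (ρ * (-(2 * k * c))) c := by
    have e1 : HasDerivAt Real.smoothTransition ρ (k * (1 - c ^ 2) - 1) :=
      ((Real.smoothTransition.contDiff (n := 1)).differentiable one_ne_zero _).hasDerivAt
    have e2 : HasDerivAt (fun c : ℝ => (k : ℝ) * (1 - c ^ 2) - 1) (-(2 * k * c)) c := by
      have := (((hasDerivAt_pow 2 c).const_sub 1).const_mul (k : ℝ)).sub_const 1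
      refine this.congr_deriv ?_
      simp
      ring
    exact e1.comp c e2
  have dsin : HasDerivAt sinC (-c / sinC c) c := by
    have := ((hasDerivAt_pow 2 c).const_sub 1).sqrt hc.ne'
    refine this.congr_deriv ?_
    change _ / (2 * sinC c) = _
    field_simp
    simp
  have dlog : HasDerivAt logC (c / sinC c ^ 2) c := by
    have h1 : HasDerivAt (fun c => 1 - Real.log (sinC c)) (-(-c / sinC c / sinC c)) c :=
      (dsin.log hs.ne').const_sub 1
    have h2 : logC =ᶠ[nhds c] fun c => 1 - Real.log (sinC c) := by
      have : ∀ᶠ c' in nhds c, 0 < 1 - c' ^ 2 := by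
        have : Continuous fun c' : ℝ => 1 - c' ^ 2 := by fun_prop
        exact continuousAt_const.eventually_lt this.continuousAt hc
      filter_upwards [this] with c' hc' using logC_eq hc'
    refine (h1.congr_of_eventuallyEq h2).congr_deriv ?_
    field_simp
  obtain ⟨j, rfl⟩ : ∃ j, n = j + 2 := ⟨n - 2, by omega⟩
  have e1 : j + 2 - 1 = j + 1 := rfl
  have dD : HasDerivAt (fun c => sinC c ^ (j + 2) * logC c ^ (j + 1))
      (((j + 2 : ℕ) * sinC c ^ (j + 1) * (-c / sinC c)) * logC c ^ (j + 1)
        + sinC c ^ (j + 2) * ((j + 1 : ℕ) * logC c ^ j * (c / sinC c ^ 2))) c :=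
    (dsin.fun_pow (j + 2)).mul (dlog.fun_pow (j + 1))
  have hD0 : sinC c ^ (j + 2) * logC c ^ (j + 1) ≠ 0 := by positivity
  have dprof : HasDerivAt (profile (j + 2) k m) _ c := ((dcut.mul (hm c)).div dD hD0).neg
  rw [dprof.deriv, ← hsq]
  simp only [profile, e1, Nat.add_sub_cancel]
  -- Once the terms from differentiating `sinC c ^ n` cancel against `n c h`, the two sides differ
  -- exactly by this contribution of the cutoff's derivative.
  have hmain : 0 ≤ 2 * k * ρ * (c * m c) / (sinC c ^ j * logC c ^ (j + 1)) := by
    have := hcm c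
    positivity
  rw [← sub_nonneg]
  convert hmain using 1
  set s := sinC c
  set l := logC c
  simp only [Pi.mul_apply]
  push_cast
  field_simp
  ring

/-! ### The pointwise estimate and the inequality with cutoff. -/

/-- The cosine of the geodesic distance. -/
def cosDist (Φ x : Sph n) : ℝ := inner ℝ (x : Ambient n) (Φ : Ambient n)

theorem continuous_cosDist (Φ : Sph n) : Continuous (cosDist Φ) :=
  continuous_subtype_val.inner continuous_const

theorem abs_cosDist_le_one (Φ x : Sph n) : |cosDist Φ x| ≤ 1 := by
  have := abs_real_inner_le_norm (x : Ambient n) (Φ : Ambient n)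
  rwa [norm_eq_of_mem_sphere, norm_eq_of_mem_sphere, one_mul] at this

theorem norm_zonal (Φ x : Sph n) :
    ‖(Φ : Ambient n) - cosDist Φ x • (x : Ambient n)‖ = sinC (cosDist Φ x) := by
  have h : ‖(Φ : Ambient n) - cosDist Φ x • (x : Ambient n)‖ ^ 2 = 1 - cosDist Φ x ^ 2 := by
    rw [norm_sub_sq_real, inner_smul_right, norm_smul, norm_eq_of_mem_sphere,
      norm_eq_of_mem_sphere, real_inner_comm, ← cosDist, Real.norm_eq_abs, mul_one, sq_abs]
    ring
  rw [sinC, ← h, Real.sqrt_sq (norm_nonneg _)]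

theorem measurable_sinC : Measurable sinC := by unfold sinC; fun_prop

theorem measurable_logC : Measurable logC := by
  unfold logC
  exact Real.measurable_log.comp (measurable_const.div measurable_sinC)

theorem integrable_abs_pow_mul_comp_cosDist (hn : n ≠ 0) (Φ : Sph n) {u : Sph n → ℝ}
    (hu : MemLp u n (surf n)) {f : ℝ → ℝ} (hf : Measurable f) {C : ℝ} (hC : ∀ c, |f c| ≤ C) :
    Integrable (fun x => |u x| ^ n * f (cosDist Φ x)) (surf n) :=
  (integrable_abs_pow hn hu).mul_bdd (c := C)
    (hf.comp (continuous_cosDist Φ).measurable).aestronglyMeasurable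
    (Filter.Eventually.of_forall fun _ => hC _)

theorem gam_pos (hn : 2 ≤ n) : 0 < gam n := by
  have : (2 : ℝ) ≤ n := by exact_mod_cast hn
  exact div_pos (by linarith) (by linarith)

theorem nat_mul_gam_pow (hn : 2 ≤ n) : n * gam n ^ n = (n - 1) * gam n ^ (n - 1) := by
  obtain ⟨j, rfl⟩ : ∃ j, n = j + 1 := ⟨n - 1, by omega⟩
  have h : ((j + 1 : ℕ) : ℝ) * gam (j + 1) = (j + 1 : ℕ) - 1 :=
    mul_div_cancel₀ _ (by positivity)
  rw [Nat.add_sub_cancel, pow_succ, ← h]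
  ring

/-- The pointwise estimate behind the Hardy inequality. -/
theorem young_cutoff (hn : 2 ≤ n) {χ s l m α β v N g : ℝ} (hχ0 : 0 ≤ χ) (hχ1 : χ ≤ 1)
    (hs : 0 < s) (hl : 0 < l) (hα : 0 ≤ α) (hβ : 0 ≤ β) (hm : |m| = α * β ^ (n - 1))
    (hN : 0 ≤ N) (hg : |g| ≤ N * s) :
    -(N * α) ^ n - χ * ((n - 1) * gam n ^ n * (|v| ^ n * (β ^ n / (s ^ n * l ^ n))))
      ≤ gam n ^ (n - 1) * (n * (|v| ^ (n - 2) * v) * -(χ * m / (s ^ n * l ^ (n - 1))) * g) := by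
  have hγ := (gam_pos hn).le
  -- The length `s` of the zonal vector reduces `s ^ n` in the test field to `s ^ (n - 1)`, so that
  -- the product is the one in Young's inequality for `N α` and `γ |v| β / (s l)`.
  have hY := young_pow (by omega : 1 ≤ n) (mul_nonneg hN hα)
    (by positivity : 0 ≤ gam n * |v| * β / (s * l))
  have hbound : |gam n ^ (n - 1) * (n * (|v| ^ (n - 2) * v) * -(χ * m / (s ^ n * l ^ (n - 1))) * g)|
      ≤ χ * (n * ((gam n * |v| * β / (s * l)) ^ (n - 1) * (N * α))) := by
    obtain ⟨j, rfl⟩ : ∃ j, n = j + 2 := ⟨n - 2, by omega⟩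
    have e1 : j + 2 - 1 = j + 1 := rfl
    simp only [e1, Nat.add_sub_cancel] at *
    simp only [abs_mul, abs_pow, abs_neg, abs_div, abs_abs, abs_of_nonneg hγ, abs_of_nonneg hχ0,
      abs_of_pos hs, abs_of_pos hl, hm, Nat.abs_cast]
    calc gam (j + 2) ^ (j + 1) * (((j + 2 : ℕ) : ℝ) * (|v| ^ j * |v|) *
          (χ * (α * β ^ (j + 1)) / (s ^ (j + 2) * l ^ (j + 1))) * |g|)
        ≤ gam (j + 2) ^ (j + 1) * (((j + 2 : ℕ) : ℝ) * (|v| ^ j * |v|) *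
          (χ * (α * β ^ (j + 1)) / (s ^ (j + 2) * l ^ (j + 1))) * (N * s)) := by gcongr
      _ = _ := by
        rw [div_pow, mul_pow, mul_pow, mul_pow]
        field_simp
        ring
  have h1 := (abs_le.1 hbound).1
  have h2 := mul_le_mul_of_nonneg_left hY hχ0
  have h3 : χ * (N * α) ^ n ≤ (N * α) ^ n := mul_le_of_le_one_left (by positivity) hχ1
  have h4 : (gam n * |v| * β / (s * l)) ^ n
      = gam n ^ n * (|v| ^ n * (β ^ n / (s ^ n * l ^ n))) := by
    rw [div_pow, mul_pow, mul_pow, mul_pow]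
    ring
  rw [h4] at h2
  linarith

/-- The Hardy inequality with a cutoff near the poles. -/
theorem integral_cut_le (hn : 2 ≤ n) (Φ : Sph n) {u : Sph n → ℝ} {Ψ : Sph n → Ambient n}
    (hu : MemLp u n (surf n)) (hΨ : MemLp Ψ n (surf n)) (hw : IsWeakGradient u Ψ) (k : ℕ)
    {m m' α β W : ℝ → ℝ} (hm : ContDiff ℝ 1 m) (hm' : ∀ c, HasDerivAt m (m' c) c)
    (hcm : ∀ c, 0 ≤ c * m c) (hα : ∀ c, 0 ≤ α c) (hβ : ∀ c, 0 ≤ β c)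
    (hαβ : ∀ c, |m c| = α c * β c ^ (n - 1))
    (hW : ∀ c, 0 < 1 - c ^ 2 → W c ≤ gam n ^ (n - 1) *
        ((n - 1) * (c * m c) / (sinC c ^ n * logC c ^ n)
          - m' c / (sinC c ^ (n - 2) * logC c ^ (n - 1)))
        - (n - 1) * gam n ^ n * (β c ^ n / (sinC c ^ n * logC c ^ n)))
    (hI : Integrable (fun x => |u x| ^ n * (cut k (cosDist Φ x) * W (cosDist Φ x))) (surf n))
    (hQ : Integrable (fun x => (‖Ψ x‖ * α (cosDist Φ x)) ^ n) (surf n)) :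
    ∫ x, |u x| ^ n * (cut k (cosDist Φ x) * W (cosDist Φ x)) ∂(surf n)
      ≤ ∫ x, (‖Ψ x‖ * α (cosDist Φ x)) ^ n ∂(surf n) := by
  obtain ⟨hR, hR0⟩ := integral_abs_pow_mul_zonal hn Φ hu hΨ hw (contDiff_profile (n := n) k hm)
  have hγ := (gam_pos hn).le
  -- Zero is replaced by `γ ^ (n - 1)` times the vanishing integral of the integration by parts
  -- identity, so that a pointwise comparison suffices.
  rw [← sub_nonpos, ← integral_sub hI hQ, ← mul_zero (gam n ^ (n - 1)), ← hR0,
    ← integral_const_mul]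
  refine integral_mono (hI.sub hQ) (hR.const_mul _) fun x => ?_
  simp only
  rw [← cosDist]
  have hg := norm_zonal Φ x
  set c := cosDist Φ x
  set N := ‖Ψ x‖
  have hN : 0 ≤ N := norm_nonneg _
  have hg' := (abs_real_inner_le_norm (Ψ x) ((Φ : Ambient n) - c • (x : Ambient n)))
  rw [hg] at hg'
  have hQ0 : 0 ≤ (N * α c) ^ n := pow_nonneg (mul_nonneg hN (hα c)) n
  rcases lt_or_ge 0 (1 - c ^ 2) with hc | hc
  · have hdiv := mul_le_mul_of_nonneg_left (le_div_profile hn k hm' hcm c)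
      (mul_nonneg (pow_nonneg hγ (n - 1)) (pow_nonneg (abs_nonneg (u x)) n))
    have hy := young_cutoff (v := u x) hn (cut_nonneg k c) (cut_le_one k c) (sinC_pos hc)
      (zero_lt_one.trans_le (one_le_logC hc)) (hα c) (hβ c) (hαβ c) hN hg'
    have hWc := mul_le_mul_of_nonneg_left (hW c hc)
      (mul_nonneg (cut_nonneg k c) (pow_nonneg (abs_nonneg (u x)) n))
    have hp : profile n k m c = -(cut k c * m c / (sinC c ^ n * logC c ^ (n - 1))) := rfl
    rw [← hp] at hy
    linarith
  · have hk : (k : ℝ) * (1 - c ^ 2) ≤ 1 :=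
      (mul_nonpos_of_nonneg_of_nonpos (Nat.cast_nonneg k) hc).trans zero_le_one
    have h1 := profile_eventually_eq_zero (n := n) k m hc
    rw [h1.deriv_eq, h1.eq_of_nhds, cut_eq_zero hk]
    simpa using hQ0

/-! ### The densities in terms of the cosine, and comparison of weights. -/

theorem densU_eq (Φ : Sph n) (u : Sph n → ℝ) (x : Sph n) :
    densU Φ u x
      = |u x| ^ n * (1 / (sinC (cosDist Φ x) ^ n * logC (cosDist Φ x) ^ n)) := by
  simp only [densU, logWeight, geoDist, Real.sin_arccos, mul_one_div]
  rfl

theorem densUt_eq (Φ : Sph n) (u : Sph n → ℝ) (x : Sph n) :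
    densUt Φ u x
      = |u x| ^ n * (1 / (sinC (cosDist Φ x) ^ (n - 2) * logC (cosDist Φ x) ^ (n - 1))) := by
  simp only [densUt, logWeight, geoDist, Real.sin_arccos, mul_one_div]
  rfl

/-- Division by zero being zero, this also covers the equator `c = 0`: for `i > 0` both sides
vanish, and for `i = 0` the tangent factor is `1`. -/
theorem div_abs_div_pow_mul (a s c l : ℝ) (i : ℕ) (hs : 0 ≤ s) :
    a / (|s / c| ^ i * l) = a * (|c| ^ i * (1 / (s ^ i * l))) := by
  rw [abs_div, div_pow, abs_of_nonneg hs]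
  simp only [div_eq_mul_inv, mul_inv, inv_inv]
  ring

theorem densV_eq (Φ : Sph n) (u : Sph n → ℝ) (x : Sph n) :
    densV Φ u x = |u x| ^ n *
      (|cosDist Φ x| ^ n * (1 / (sinC (cosDist Φ x) ^ n * logC (cosDist Φ x) ^ n))) := by
  rw [← div_abs_div_pow_mul _ _ _ _ _ (sinC_nonneg _)]
  simp only [densV, logWeight, geoDist, Real.sin_arccos, Real.tan_arccos]
  rfl

theorem densVt_eq (Φ : Sph n) (u : Sph n → ℝ) (x : Sph n) :
    densVt Φ u x = |u x| ^ n * (|cosDist Φ x| ^ (n - 2) *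
      (1 / (sinC (cosDist Φ x) ^ (n - 2) * logC (cosDist Φ x) ^ (n - 1)))) := by
  rw [← div_abs_div_pow_mul _ _ _ _ _ (sinC_nonneg _)]
  simp only [densVt, logWeight, geoDist, Real.sin_arccos, Real.tan_arccos]
  rfl

theorem weight_nonneg (i j : ℕ) (c : ℝ) : 0 ≤ 1 / (sinC c ^ i * logC c ^ j) :=
  one_div_nonneg.2 (mul_nonneg (pow_nonneg (sinC_nonneg c) i) (pow_nonneg (logC_nonneg c) j))

theorem measurable_weight (i j : ℕ) : Measurable fun c => 1 / (sinC c ^ i * logC c ^ j) :=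
  measurable_const.div ((measurable_sinC.pow_const i).mul (measurable_logC.pow_const j))

/-- At the poles `e / 0 = 0` and `log 0 = 0`, so any positive power of the logarithm in the
denominator gives the weight the value `0`. -/
theorem weight_eq_zero {i j : ℕ} (hj : j ≠ 0) {c : ℝ} (hc : 1 - c ^ 2 ≤ 0) :
    1 / (sinC c ^ i * logC c ^ j) = 0 := by
  rw [logC_of_nonpos hc, zero_pow hj, mul_zero, div_zero]

theorem cut_mul_weight_le (k i j : ℕ) (c : ℝ) :
    |cut k c * (1 / (sinC c ^ i * logC c ^ j))| ≤ (k : ℝ) ^ i := by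
  rw [abs_of_nonneg (mul_nonneg (cut_nonneg k c) (weight_nonneg i j c))]
  rcases le_or_gt (k * (1 - c ^ 2)) 1 with h | h
  · rw [cut_eq_zero h, zero_mul]
    positivity
  have hk : (0 : ℝ) ≤ k := Nat.cast_nonneg k
  have hc : 0 < 1 - c ^ 2 := by
    by_contra! hc
    linarith [mul_nonpos_of_nonneg_of_nonpos hk hc]
  have hs := sinC_pos hc
  -- On the support of the cutoff `1 < k s ^ 2 ≤ k s`, hence `1 / s ≤ k`.
  have h1 : 1 ≤ k * sinC c := by
    rw [← sq_sinC hc.le] at h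
    have : k * sinC c ^ 2 ≤ k * sinC c := by
      gcongr
      exact pow_le_of_le_one hs.le (sinC_le_one c) two_ne_zero
    linarith
  have h2 : 1 ≤ logC c ^ j := one_le_pow₀ (one_le_logC hc)
  calc cut k c * (1 / (sinC c ^ i * logC c ^ j))
      ≤ 1 * (1 / (sinC c ^ i * logC c ^ j)) := by
        exact mul_le_mul_of_nonneg_right (cut_le_one k c) (weight_nonneg i j c)
    _ ≤ (k : ℝ) ^ i := by
        rw [one_mul, div_le_iff₀ (by positivity)]
        calc (1 : ℝ) ≤ (k * sinC c) ^ i * logC c ^ j :=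
              one_le_mul_of_one_le_of_one_le (one_le_pow₀ h1) h2
          _ = _ := by rw [mul_pow]; ring

theorem weight_lower_eq (hn : 2 ≤ n) {c : ℝ} (hc : 0 < 1 - c ^ 2) :
    1 / (sinC c ^ (n - 2) * logC c ^ (n - 1))
      = sinC c * (sinC c * logC c) * (1 / (sinC c ^ n * logC c ^ n)) := by
  obtain ⟨j, rfl⟩ : ∃ j, n = j + 2 := ⟨n - 2, by omega⟩
  have e1 : j + 2 - 1 = j + 1 := rfl
  have hs := sinC_pos hc
  have hL : 0 < logC c := zero_lt_one.trans_le (one_le_logC hc)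
  rw [e1, Nat.add_sub_cancel]
  field_simp
  ring

theorem weight_lower_le_sinC_mul (hn : 2 ≤ n) (c : ℝ) :
    1 / (sinC c ^ (n - 2) * logC c ^ (n - 1)) ≤ sinC c * (1 / (sinC c ^ n * logC c ^ n)) := by
  rcases lt_or_ge 0 (1 - c ^ 2) with hc | hc
  · rw [weight_lower_eq hn hc]
    gcongr
    · exact weight_nonneg n n c
    · exact mul_le_of_le_one_right (sinC_nonneg c) (sinC_mul_logC_le_one hc)
  · rw [weight_eq_zero (by omega) hc]
    exact mul_nonneg (sinC_nonneg c) (weight_nonneg n n c)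

theorem weight_lower_le (hn : 2 ≤ n) (c : ℝ) :
    1 / (sinC c ^ (n - 2) * logC c ^ (n - 1)) ≤ 1 / (sinC c ^ n * logC c ^ n) :=
  (weight_lower_le_sinC_mul hn c).trans
    (mul_le_of_le_one_left (weight_nonneg n n c) (sinC_le_one c))

/-- Where `s ≤ δ`, the lower weight is at most `s`, hence `δ`, times the main one; where `s > δ`, it
is bounded because `L ≥ 1`. A small `δ` lets the lower-order term be absorbed. -/
theorem weight_lower_absorb (hn : 2 ≤ n) {δ : ℝ} (hδ : 0 < δ) (c : ℝ) :
    1 / (sinC c ^ (n - 2) * logC c ^ (n - 1))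
      ≤ δ * (1 / (sinC c ^ n * logC c ^ n)) + (1 / δ) ^ (n - 2) := by
  have hw := weight_nonneg n n c
  rcases le_or_gt (sinC c) δ with h | h
  · have h1 := (weight_lower_le_sinC_mul hn c).trans (mul_le_mul_of_nonneg_right h hw)
    have : (0 : ℝ) ≤ (1 / δ) ^ (n - 2) := by positivity
    linarith
  · have hc : 0 < 1 - c ^ 2 := by
      by_contra! hc
      rw [sinC_eq_zero hc] at h
      linarith
    have hL : 1 ≤ logC c ^ (n - 1) := one_le_pow₀ (one_le_logC hc)
    have hb : δ ^ (n - 2) * 1 ≤ sinC c ^ (n - 2) * logC c ^ (n - 1) :=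
      mul_le_mul (pow_le_pow_left₀ hδ.le h.le _) hL zero_le_one (pow_nonneg (sinC_nonneg c) _)
    have := one_div_le_one_div_of_le (by positivity) hb
    rw [mul_one, ← one_div_pow] at this
    linarith [mul_nonneg hδ.le hw]

theorem hasDerivAt_abs_pow_mul_self (j : ℕ) (c : ℝ) :
    HasDerivAt (fun c : ℝ => |c| ^ j * c) ((j + 1) * |c| ^ j) c := by
  rcases lt_trichotomy c 0 with h | rfl | h
  · have h1 : (fun c : ℝ => |c| ^ j * c) =ᶠ[nhds c] fun c => (-1) ^ j * c ^ (j + 1) := by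
      filter_upwards [gt_mem_nhds h] with y hy
      rw [abs_of_neg hy, neg_pow]
      ring
    refine (((hasDerivAt_pow (j + 1) c).const_mul _).congr_of_eventuallyEq h1).congr_deriv ?_
    rw [abs_of_neg h, neg_pow c j]
    simp only [Nat.add_sub_cancel, Nat.cast_add, Nat.cast_one]
    ring
  · rw [hasDerivAt_iff_tendsto_slope]
    have hcont : Continuous fun y : ℝ => |y| ^ j := continuous_abs.pow j
    -- For `j = 0` both sides are `1` by `0 ^ 0 = 1`; for `j > 0` both vanish.
    have h0 : ((j : ℝ) + 1) * |(0 : ℝ)| ^ j = |(0 : ℝ)| ^ j := by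
      rcases j with _ | j <;> simp
    rw [h0]
    refine (hcont.continuousAt.tendsto.mono_left nhdsWithin_le_nhds).congr' ?_
    filter_upwards [self_mem_nhdsWithin] with y hy
    have hy' : y ≠ 0 := hy
    simp [slope_def_field, hy']
  · have h1 : (fun c : ℝ => |c| ^ j * c) =ᶠ[nhds c] fun c => c ^ (j + 1) := by
      filter_upwards [lt_mem_nhds h] with y hy
      rw [abs_of_pos hy, pow_succ]
    refine ((hasDerivAt_pow (j + 1) c).congr_of_eventuallyEq h1).congr_deriv ?_
    rw [abs_of_pos h]
    simp

theorem contDiff_abs_pow_mul_self (j : ℕ) : ContDiff ℝ 1 fun c : ℝ => |c| ^ j * c := by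
  rw [contDiff_one_iff_deriv]
  refine ⟨fun c => (hasDerivAt_abs_pow_mul_self j c).differentiableAt, ?_⟩
  rw [funext fun c => (hasDerivAt_abs_pow_mul_self j c).deriv]
  fun_prop

/-! ### Removal of the cutoff and the two Hardy inequalities. -/

theorem tendsto_integral_cut (Φ : Sph n) {u : Sph n → ℝ} {W : ℝ → ℝ}
    (hI : Integrable (fun x => |u x| ^ n * W (cosDist Φ x)) (surf n))
    (hW : ∀ c, 1 - c ^ 2 ≤ 0 → W c = 0) :
    Filter.Tendsto (fun k => ∫ x, |u x| ^ n * (cut k (cosDist Φ x) * W (cosDist Φ x)) ∂(surf n))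
      Filter.atTop (nhds (∫ x, |u x| ^ n * W (cosDist Φ x) ∂(surf n))) := by
  refine tendsto_integral_of_dominated_convergence
    (fun x => ‖|u x| ^ n * W (cosDist Φ x)‖) (fun k => ?_) hI.norm
    (fun k => Filter.Eventually.of_forall fun x => ?_) (Filter.Eventually.of_forall fun x => ?_)
  · have hc := ((continuous_cut k).comp (continuous_cosDist Φ)).aestronglyMeasurable
      (μ := surf n)
    refine (hc.mul hI.1).congr (Filter.Eventually.of_forall fun x => ?_)
    simp only [Pi.mul_apply, Function.comp_apply]
    ring
  · rw [mul_left_comm, norm_mul, Real.norm_eq_abs, abs_of_nonneg (cut_nonneg _ _)]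
    exact mul_le_of_le_one_left (norm_nonneg _) (cut_le_one _ _)
  · refine tendsto_const_nhds.congr' ?_
    rcases lt_or_ge 0 (1 - cosDist Φ x ^ 2) with hc | hc
    · filter_upwards [cut_eventually_eq_one hc] with k hk
      rw [hk, one_mul]
    · simp [hW _ hc]

theorem integrable_mul_comp_cosDist {f : Sph n → ℝ} (hf : Integrable f (surf n)) (Φ : Sph n)
    {g : ℝ → ℝ} (hg : Measurable g) (hg1 : ∀ c, |c| ≤ 1 → |g c| ≤ 1) :
    Integrable (fun x => f x * g (cosDist Φ x)) (surf n) :=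
  hf.mul_bdd (c := 1) (hg.comp (continuous_cosDist Φ).measurable).aestronglyMeasurable
    (Filter.Eventually.of_forall fun x => hg1 _ (abs_cosDist_le_one Φ x))

theorem integrable_cut_mul_weight (hn : 2 ≤ n) (Φ : Sph n) {u : Sph n → ℝ}
    (hu : MemLp u n (surf n)) (k i j : ℕ) :
    Integrable (fun x => |u x| ^ n * (cut k (cosDist Φ x) *
      (1 / (sinC (cosDist Φ x) ^ i * logC (cosDist Φ x) ^ j)))) (surf n) :=
  integrable_abs_pow_mul_comp_cosDist (by omega) Φ hu
    (f := fun c => cut k c * (1 / (sinC c ^ i * logC c ^ j)))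
    ((continuous_cut k).measurable.mul (measurable_weight i j)) (cut_mul_weight_le k i j)

section Hardy

variable {u : Sph n → ℝ} {Ψ : Sph n → Ambient n}

theorem integrable_densH (hn : 2 ≤ n) (hΨ : MemLp Ψ n (surf n)) :
    Integrable (densH Ψ) (surf n) := hΨ.integrable_norm_pow (by omega)

theorem densQ_eq (Φ : Sph n) (x : Sph n) : densQ Φ Ψ x = (‖Ψ x‖ * |cosDist Φ x|) ^ n := by
  have h := abs_le.1 (abs_cosDist_le_one Φ x)
  rw [densQ, geoDist, ← cosDist, Real.cos_arccos h.1 h.2, mul_pow]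

theorem integrable_densQ (hn : 2 ≤ n) (Φ : Sph n) (hΨ : MemLp Ψ n (surf n)) :
    Integrable (densQ Φ Ψ) (surf n) := by
  refine (integrable_mul_comp_cosDist (integrable_densH hn hΨ) Φ (g := fun c => |c| ^ n)
    (by fun_prop) fun c hc => ?_).congr (Filter.Eventually.of_forall fun x => ?_)
  · rw [abs_pow, abs_abs]
    exact pow_le_one₀ (abs_nonneg c) hc
  · simp only [densH, densQ_eq, mul_pow]

/-- The first Hardy inequality with a cutoff near the poles. -/
theorem integral_cut_densU_le (hn : 2 ≤ n) (Φ : Sph n) (hu : MemLp u n (surf n))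
    (hΨ : MemLp Ψ n (surf n)) (hw : IsWeakGradient u Ψ) (k : ℕ) :
    ∫ x, |u x| ^ n * (cut k (cosDist Φ x) *
        (gam n ^ n * (1 / (sinC (cosDist Φ x) ^ n * logC (cosDist Φ x) ^ n))
        - n * gam n ^ (n - 1) *
          (1 / (sinC (cosDist Φ x) ^ (n - 2) * logC (cosDist Φ x) ^ (n - 1))))) ∂(surf n)
      ≤ ∫ x, densQ Φ Ψ x ∂(surf n) := by
  simp only [densQ_eq]
  refine integral_cut_le hn Φ hu hΨ hw k (m := id) (m' := fun _ => 1) (α := fun c => |c|)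
    (β := fun _ => 1)
    (W := fun c => gam n ^ n * (1 / (sinC c ^ n * logC c ^ n))
        - n * gam n ^ (n - 1) * (1 / (sinC c ^ (n - 2) * logC c ^ (n - 1))))
    contDiff_id (fun c => hasDerivAt_id c) (fun c => mul_self_nonneg c)
    (fun c => abs_nonneg c) (fun _ => zero_le_one) (fun c => by simp) (fun c hc => ?_) ?_ ?_
  · have hs := sinC_pos hc
    have hL := one_le_logC hc
    have hlow := weight_lower_eq hn hc
    have hγ := nat_mul_gam_pow hn
    have hcc : c * id c = 1 - sinC c ^ 2 := by rw [sq_sinC hc.le, id]; ring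
    rw [hcc, one_pow, mul_div_assoc, sub_div,
      ← mul_one_div (sinC c ^ 2)]
    set w := 1 / (sinC c ^ n * logC c ^ n)
    set wt := 1 / (sinC c ^ (n - 2) * logC c ^ (n - 1))
    have hw0 : 0 ≤ w := weight_nonneg n n c
    -- Replacing `c ^ 2` by `1 - s ^ 2` costs `(n - 1) γ ^ (n - 1) s ^ 2 w`. As `L ≥ 1` this is at
    -- most `(n - 1) γ ^ (n - 1) wt`, which with the `γ ^ (n - 1) wt` coming from `m' = 1` makes the
    -- coefficient `n γ ^ (n - 1)`.
    have h1 : sinC c ^ 2 * w ≤ wt := by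
      rw [hlow]
      have : sinC c * sinC c ≤ sinC c * (sinC c * logC c) := by
        gcongr
        exact le_mul_of_one_le_right hs.le hL
      rw [sq]
      gcongr
    have hn1 : (0 : ℝ) ≤ n - 1 := by
      have : (2 : ℝ) ≤ n := by exact_mod_cast hn
      linarith
    have h2 := mul_le_mul_of_nonneg_left h1
      (mul_nonneg (pow_nonneg (gam_pos hn).le (n - 1)) hn1)
    have h3 : (n * gam n ^ n) * w = ((n - 1) * gam n ^ (n - 1)) * w := by rw [hγ]
    linarith
  · have i1 := (integrable_cut_mul_weight hn Φ hu k n n).const_mul (gam n ^ n)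
    have i2 := (integrable_cut_mul_weight hn Φ hu k (n - 2) (n - 1)).const_mul
      (n * gam n ^ (n - 1))
    refine (i1.sub i2).congr (Filter.Eventually.of_forall fun x => ?_)
    simp only [Pi.sub_apply]
    ring
  · exact (integrable_densQ hn Φ hΨ).congr (Filter.Eventually.of_forall (densQ_eq Φ))

/-- The lower-order term in the cutoff inequality is absorbed into half of the main term plus a
multiple of `|u| ^ n`. The resulting bound does not depend on the cutoff, and Fatou's lemma passes
it to the limit. -/
theorem integrable_densU (hn : 2 ≤ n) (Φ : Sph n) (hu : MemLp u n (surf n))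
    (hΨ : MemLp Ψ n (surf n)) (hw : IsWeakGradient u Ψ) : Integrable (densU Φ u) (surf n) := by
  have hγ := gam_pos hn
  have hn0 : (0 : ℝ) < n := by exact_mod_cast (by omega : 0 < n)
  set K : ℝ := n * gam n ^ (n - 1)
  have hK0 : 0 < K := by positivity
  -- Chosen so that `K δ` is half of the leading coefficient `γ ^ n`.
  set δ : ℝ := gam n ^ n / (2 * K)
  have hδ : 0 < δ := by positivity
  have hKδ : K * δ = gam n ^ n / 2 := by
    simp only [δ]
    field_simp
  set C : ℝ := K * (1 / δ) ^ (n - 2)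
  have hC : 0 ≤ C := by positivity
  have hint := integrable_abs_pow (by omega) hu
  set F : ℕ → Sph n → ℝ := fun k x => |u x| ^ n * (cut k (cosDist Φ x) *
      (1 / (sinC (cosDist Φ x) ^ n * logC (cosDist Φ x) ^ n))) with hF
  have hFi : ∀ k, Integrable (F k) (surf n) := fun k => integrable_cut_mul_weight hn Φ hu k n n
  have hF0 : ∀ k x, 0 ≤ F k x := fun k x =>
    mul_nonneg (by positivity) (mul_nonneg (cut_nonneg _ _) (weight_nonneg _ _ _))
  set B : ℝ := (∫ x, densQ Φ Ψ x ∂(surf n) + C * ∫ x, |u x| ^ n ∂(surf n)) / (gam n ^ n / 2)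
  have hB : ∀ k, ∫ x, F k x ∂(surf n) ≤ B := by
    intro k
    rw [le_div_iff₀' (by positivity)]
    have i1 := (hFi k).const_mul (gam n ^ n)
    have i2 := (integrable_cut_mul_weight hn Φ hu k (n - 2) (n - 1)).const_mul K
    have i3 : Integrable (fun x => |u x| ^ n * (cut k (cosDist Φ x) *
        (gam n ^ n * (1 / (sinC (cosDist Φ x) ^ n * logC (cosDist Φ x) ^ n))
        - K * (1 / (sinC (cosDist Φ x) ^ (n - 2) * logC (cosDist Φ x) ^ (n - 1))))))
        (surf n) := by
      refine (i1.sub i2).congr (Filter.Eventually.of_forall fun x => ?_)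
      simp only [Pi.sub_apply, hF]
      ring
    refine le_trans ?_ (add_le_add_left (integral_cut_densU_le hn Φ hu hΨ hw k) _)
    rw [← integral_const_mul, ← integral_const_mul, ← integral_add i3 (hint.const_mul C)]
    refine integral_mono ((hFi k).const_mul _) (i3.add (hint.const_mul C)) fun x => ?_
    simp only [hF]
    set c := cosDist Φ x
    have h1 := mul_le_mul_of_nonneg_left (weight_lower_absorb hn hδ c) hK0.le
    rw [mul_add, ← mul_assoc, hKδ] at h1
    have h2 : C * cut k c ≤ C := mul_le_of_le_one_right hC (cut_le_one k c)
    set w := 1 / (sinC c ^ n * logC c ^ n)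
    set wt := 1 / (sinC c ^ (n - 2) * logC c ^ (n - 1))
    have h3 := mul_le_mul_of_nonneg_left h1 (cut_nonneg k c)
    have h4 : gam n ^ n / 2 * (cut k c * w) ≤ cut k c * (gam n ^ n * w - K * wt) + C := by
      have : K * (1 / δ) ^ (n - 2) = C := rfl
      rw [this] at h3
      linarith
    have h5 := mul_le_mul_of_nonneg_left h4 (pow_nonneg (abs_nonneg (u x)) n)
    linarith
  have hlim : ∀ x, Filter.Tendsto (fun k => F k x) Filter.atTop (nhds (densU Φ u x)) := by
    intro x
    rw [densU_eq]
    refine tendsto_const_nhds.congr' ?_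
    rcases lt_or_ge 0 (1 - cosDist Φ x ^ 2) with hc | hc
    · filter_upwards [cut_eventually_eq_one hc] with k hk
      simp only [hF]
      rw [hk, one_mul]
    · refine Filter.Eventually.of_forall fun k => ?_
      simp only [hF]
      rw [weight_eq_zero (by omega) hc, mul_zero, mul_zero, mul_zero]
  have hmeas : AEStronglyMeasurable (densU Φ u) (surf n) :=
    aestronglyMeasurable_of_tendsto_ae _ (fun k => (hFi k).1) (Filter.Eventually.of_forall hlim)
  rw [← memLp_one_iff_integrable]
  refine ⟨hmeas, ?_⟩
  -- Fatou's lemma in the form of lower semicontinuity of the `L^1` norm.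
  refine (Lp.eLpNorm_le_of_ae_tendsto (C := ENNReal.ofReal B) (u := Filter.atTop) (f := F)
    (Filter.Eventually.of_forall fun k => ?_) (fun k => (hFi k).1)
    (Filter.Eventually.of_forall hlim)).trans_lt ENNReal.ofReal_lt_top
  rw [eLpNorm_one_eq_lintegral_enorm, ← ofReal_integral_norm_eq_lintegral_enorm (hFi k)]
  refine ENNReal.ofReal_le_ofReal ?_
  simpa only [Real.norm_eq_abs, abs_of_nonneg (hF0 k _)] using hB k

theorem integrable_densUt (hn : 2 ≤ n) (Φ : Sph n) (hu : MemLp u n (surf n))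
    (h : Integrable (densU Φ u) (surf n)) : Integrable (densUt Φ u) (surf n) := by
  refine h.mono' ?_ (Filter.Eventually.of_forall fun x => ?_)
  · rw [funext (densUt_eq Φ u)]
    exact (integrable_abs_pow (by omega) hu).1.mul
      ((measurable_weight (n - 2) (n - 1)).comp
        (continuous_cosDist Φ).measurable).aestronglyMeasurable
  · rw [densUt_eq, densU_eq, Real.norm_eq_abs,
      abs_of_nonneg (mul_nonneg (by positivity) (weight_nonneg _ _ _))]
    exact mul_le_mul_of_nonneg_left (weight_lower_le hn _) (by positivity)

theorem integrable_densV (Φ : Sph n) (h : Integrable (densU Φ u) (surf n)) :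
    Integrable (densV Φ u) (surf n) := by
  refine (integrable_mul_comp_cosDist h Φ (g := fun c => |c| ^ n)
    (by fun_prop) fun c hc => ?_).congr (Filter.Eventually.of_forall fun x => ?_)
  · rw [abs_pow, abs_abs]
    exact pow_le_one₀ (abs_nonneg c) hc
  · simp only [densU_eq, densV_eq]
    ring

theorem integrable_densVt (Φ : Sph n) (h : Integrable (densUt Φ u) (surf n)) :
    Integrable (densVt Φ u) (surf n) := by
  refine (integrable_mul_comp_cosDist h Φ (g := fun c => |c| ^ (n - 2))
    (by fun_prop) fun c hc => ?_).congr (Filter.Eventually.of_forall fun x => ?_)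
  · rw [abs_pow, abs_abs]
    exact pow_le_one₀ (abs_nonneg c) hc
  · simp only [densUt_eq, densVt_eq]
    ring

theorem hardy_densU (hn : 2 ≤ n) (Φ : Sph n) (hu : MemLp u n (surf n))
    (hΨ : MemLp Ψ n (surf n)) (hw : IsWeakGradient u Ψ) :
    gam n ^ n * ∫ x, densU Φ u x ∂(surf n)
      ≤ ∫ x, densQ Φ Ψ x ∂(surf n)
        + n * gam n ^ (n - 1) * ∫ x, densUt Φ u x ∂(surf n) := by
  have hU := integrable_densU hn Φ hu hΨ hw
  have hUt := integrable_densUt hn Φ hu hU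
  have heq : ∀ x, |u x| ^ n *
        (gam n ^ n * (1 / (sinC (cosDist Φ x) ^ n * logC (cosDist Φ x) ^ n))
        - n * gam n ^ (n - 1) *
          (1 / (sinC (cosDist Φ x) ^ (n - 2) * logC (cosDist Φ x) ^ (n - 1))))
      = gam n ^ n * densU Φ u x - n * gam n ^ (n - 1) * densUt Φ u x := fun x => by
    rw [densU_eq, densUt_eq]
    ring
  have hI := (hU.const_mul (gam n ^ n)).sub (hUt.const_mul (n * gam n ^ (n - 1)))
  have hlim := tendsto_integral_cut Φ (u := u)
    (W := fun c => gam n ^ n * (1 / (sinC c ^ n * logC c ^ n))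
        - n * gam n ^ (n - 1) * (1 / (sinC c ^ (n - 2) * logC c ^ (n - 1))))
    (hI.congr (Filter.Eventually.of_forall fun x => (heq x).symm))
    (fun c hc => by
      rw [weight_eq_zero (by omega) hc, weight_eq_zero (by omega) hc, mul_zero, mul_zero, sub_zero])
  have := le_of_tendsto hlim (Filter.Eventually.of_forall (integral_cut_densU_le hn Φ hu hΨ hw))
  simp only [heq] at this
  rw [integral_sub (hU.const_mul _) (hUt.const_mul _), integral_const_mul,
    integral_const_mul] at this
  linarith

theorem hardy_densV (hn : 2 ≤ n) (Φ : Sph n) (hu : MemLp u n (surf n))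
    (hΨ : MemLp Ψ n (surf n)) (hw : IsWeakGradient u Ψ) :
    gam n ^ n * ∫ x, densV Φ u x ∂(surf n)
      ≤ ∫ x, densH Ψ x ∂(surf n)
        + ((n : ℝ) - 1) * gam n ^ (n - 1) * ∫ x, densVt Φ u x ∂(surf n) := by
  have hU := integrable_densU hn Φ hu hΨ hw
  have hV := integrable_densV Φ hU
  have hVt := integrable_densVt Φ (integrable_densUt hn Φ hu hU)
  set W : ℝ → ℝ := fun c => gam n ^ n * (|c| ^ n * (1 / (sinC c ^ n * logC c ^ n)))
        - (n - 1) * gam n ^ (n - 1) *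
          (|c| ^ (n - 2) * (1 / (sinC c ^ (n - 2) * logC c ^ (n - 1)))) with hW
  have heq : ∀ x, |u x| ^ n * W (cosDist Φ x)
      = gam n ^ n * densV Φ u x - (n - 1) * gam n ^ (n - 1) * densVt Φ u x := fun x => by
    rw [densV_eq, densVt_eq]
    ring
  have hI : Integrable (fun x => |u x| ^ n * W (cosDist Φ x)) (surf n) :=
    ((hV.const_mul (gam n ^ n)).sub (hVt.const_mul ((n - 1) * gam n ^ (n - 1)))).congr
      (Filter.Eventually.of_forall fun x => (heq x).symm)
  have hcut : ∀ k, ∫ x, |u x| ^ n * (cut k (cosDist Φ x) * W (cosDist Φ x)) ∂(surf n)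
      ≤ ∫ x, densH Ψ x ∂(surf n) := by
    intro k
    have hH : ∀ x, densH Ψ x = (‖Ψ x‖ * (fun _ : ℝ => (1 : ℝ)) (cosDist Φ x)) ^ n := fun x => by
      simp [densH]
    simp only [hH]
    -- Here `c m = |c| ^ n = β ^ n`, so the main terms combine exactly, and `m' = (n - 1) |c| ^ (n -
    -- 2)` produces the factor `n - 1` of the lower-order term.
    refine integral_cut_le hn Φ hu hΨ hw k (m := fun c => |c| ^ (n - 2) * c)
      (m' := fun c => (n - 1) * |c| ^ (n - 2)) (β := fun c => |c|)
      (contDiff_abs_pow_mul_self _) (fun c => ?_) (fun c => ?_) (fun _ => zero_le_one)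
      (fun c => abs_nonneg c) (fun c => ?_) (fun c hc => ?_) ?_ ?_
    · refine (hasDerivAt_abs_pow_mul_self (n - 2) c).congr_deriv ?_
      rw [Nat.cast_sub hn]
      push_cast
      ring
    · rw [mul_left_comm]
      exact mul_nonneg (by positivity) (mul_self_nonneg c)
    · rw [abs_mul, abs_pow, abs_abs, ← pow_succ, one_mul]
      congr 1
      omega
    · have hγ := nat_mul_gam_pow hn
      have hcc : c * (|c| ^ (n - 2) * c) = |c| ^ n := by
        obtain ⟨j, rfl⟩ : ∃ j, n = j + 2 := ⟨n - 2, by omega⟩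
        rw [Nat.add_sub_cancel, pow_add, sq_abs]
        ring
      rw [hcc]
      simp only [hW, div_eq_mul_one_div (_ * _) (_ * _), div_eq_mul_one_div (|c| ^ n) (_ * _)]
      set w := 1 / (sinC c ^ n * logC c ^ n)
      set wt := 1 / (sinC c ^ (n - 2) * logC c ^ (n - 1))
      have h3 : (n * gam n ^ n) * (|c| ^ n * w) = ((n - 1) * gam n ^ (n - 1)) * (|c| ^ n * w) := by
        rw [hγ]
      linarith
    · refine (hI.bdd_mul (c := 1) ((continuous_cut k).comp
        (continuous_cosDist Φ)).aestronglyMeasurable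
        (Filter.Eventually.of_forall fun x => ?_)).congr (Filter.Eventually.of_forall fun x => ?_)
      · rw [Function.comp_apply, Real.norm_eq_abs, abs_of_nonneg (cut_nonneg _ _)]
        exact cut_le_one _ _
      · simp only [Function.comp_apply]
        ring
    · simpa only [← hH] using integrable_densH hn hΨ
  have hlim := tendsto_integral_cut Φ (u := u) hI (fun c hc => by
    simp only [hW]
    rw [weight_eq_zero (by omega) hc, weight_eq_zero (by omega) hc]
    simp)
  have := le_of_tendsto hlim (Filter.Eventually.of_forall hcut)
  simp only [heq] at this
  rw [integral_sub (hV.const_mul _) (hVt.const_mul _), integral_const_mul,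
    integral_const_mul] at this
  linarith

/-! ### Membership of the weighted quotients in `L^n`. -/

theorem memLp_of_integrable_abs_pow (hn : n ≠ 0) {f : Sph n → ℝ}
    (hf : AEStronglyMeasurable f (surf n)) (h : Integrable (fun x => |f x| ^ n) (surf n)) :
    MemLp f n (surf n) := by
  rw [← integrable_norm_rpow_iff hf (by exact_mod_cast hn) (by simp)]
  simpa using h

theorem measurable_geoDist (Φ : Sph n) : Measurable (geoDist Φ) :=
  (Real.continuous_arccos.comp (continuous_cosDist Φ)).measurable

theorem measurable_logWeight (Φ : Sph n) : Measurable (logWeight Φ) :=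
  Real.measurable_log.comp
    (measurable_const.div (Real.measurable_sin.comp (measurable_geoDist Φ)))

theorem logWeight_nonneg (Φ x : Sph n) : 0 ≤ logWeight Φ x := by
  simp only [logWeight, geoDist, Real.sin_arccos]
  exact logC_nonneg (cosDist Φ x)

theorem memLp_div_sin (hn : n ≠ 0) (Φ : Sph n) (hu : MemLp u n (surf n))
    (h : Integrable (densU Φ u) (surf n)) :
    MemLp (fun x => u x / (Real.sin (geoDist Φ x) * logWeight Φ x)) n (surf n) := by
  refine memLp_of_integrable_abs_pow hn (hu.1.aemeasurable.div
    ((Real.measurable_sin.comp (measurable_geoDist Φ)).mul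
      (measurable_logWeight Φ)).aemeasurable).aestronglyMeasurable
    (h.congr (Filter.Eventually.of_forall fun x => ?_))
  have hs : 0 ≤ Real.sin (geoDist Φ x) := Real.sin_nonneg_of_nonneg_of_le_pi
    (Real.arccos_nonneg _) (Real.arccos_le_pi _)
  simp only [densU]
  rw [abs_div, abs_mul, abs_of_nonneg hs, abs_of_nonneg (logWeight_nonneg Φ x), div_pow, mul_pow]

theorem memLp_div_tan (hn : n ≠ 0) (Φ : Sph n) (hu : MemLp u n (surf n))
    (h : Integrable (densV Φ u) (surf n)) :
    MemLp (fun x => u x / (Real.tan (geoDist Φ x) * logWeight Φ x)) n (surf n) := by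
  have ht : Measurable fun x => Real.tan (geoDist Φ x) := by
    simp only [Real.tan_eq_sin_div_cos]
    exact (Real.measurable_sin.comp (measurable_geoDist Φ)).div
      (Real.measurable_cos.comp (measurable_geoDist Φ))
  refine memLp_of_integrable_abs_pow hn (hu.1.aemeasurable.div
    (ht.mul (measurable_logWeight Φ)).aemeasurable).aestronglyMeasurable
    (h.congr (Filter.Eventually.of_forall fun x => ?_))
  simp only [densV]
  rw [abs_div, abs_mul, abs_of_nonneg (logWeight_nonneg Φ x), div_pow, mul_pow]

end Hardy

end

end SphereHardy

theorem mainTheorem5 (n : ℕ) (hn : 2 ≤ n) (Φ : SphereHardy.Sph n)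
    (u : SphereHardy.Sph n → ℝ) (hu : SphereHardy.MemSobolev u (n : ENNReal)) :
    MemLp (fun x => u x / (Real.sin (SphereHardy.geoDist Φ x) * SphereHardy.logWeight Φ x))
        (n : ENNReal) (SphereHardy.surf n) ∧
    MemLp (fun x => u x / (Real.tan (SphereHardy.geoDist Φ x) * SphereHardy.logWeight Φ x))
        (n : ENNReal) (SphereHardy.surf n) ∧
    Integrable (SphereHardy.densU Φ u) (SphereHardy.surf n) ∧
    Integrable (SphereHardy.densUt Φ u) (SphereHardy.surf n) ∧
    Integrable (SphereHardy.densV Φ u) (SphereHardy.surf n) ∧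
    Integrable (SphereHardy.densVt Φ u) (SphereHardy.surf n) ∧
    ∀ Ψ : SphereHardy.Sph n → SphereHardy.Ambient n, SphereHardy.IsWeakGradient u Ψ →
      Integrable (SphereHardy.densH Ψ) (SphereHardy.surf n) ∧
      Integrable (SphereHardy.densQ Φ Ψ) (SphereHardy.surf n) ∧
      SphereHardy.gam n ^ n * ∫ x, SphereHardy.densU Φ u x ∂(SphereHardy.surf n)
        ≤ ∫ x, SphereHardy.densQ Φ Ψ x ∂(SphereHardy.surf n)
          + (n : ℝ) * SphereHardy.gam n ^ (n - 1)
            * ∫ x, SphereHardy.densUt Φ u x ∂(SphereHardy.surf n) ∧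
      SphereHardy.gam n ^ n * ∫ x, SphereHardy.densV Φ u x ∂(SphereHardy.surf n)
        ≤ ∫ x, SphereHardy.densH Ψ x ∂(SphereHardy.surf n)
          + ((n : ℝ) - 1) * SphereHardy.gam n ^ (n - 1)
            * ∫ x, SphereHardy.densVt Φ u x ∂(SphereHardy.surf n) := by
  open SphereHardy in
  obtain ⟨hun, Ψ₀, hΨ₀, hΨ₀n⟩ := hu
  have hU := integrable_densU hn Φ hun hΨ₀n hΨ₀
  have hUt := integrable_densUt hn Φ hun hU
  have hV := integrable_densV Φ hU
  refine ⟨memLp_div_sin (by omega) Φ hun hU, memLp_div_tan (by omega) Φ hun hV, hU, hUt, hV,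
    integrable_densVt Φ hUt, fun Ψ hΨ => ?_⟩
  -- An arbitrary weak gradient is only assumed integrable; uniqueness transfers the `L^n` bound
  -- from the one supplied by `MemSobolev`.
  have hΨn : MemLp Ψ n (surf n) := hΨ₀n.ae_eq (hΨ₀.ae_eq hΨ)
  exact ⟨integrable_densH hn hΨn, integrable_densQ hn Φ hΨn, hardy_densU hn Φ hun hΨn hΨ,
    hardy_densV hn Φ hun hΨn hΨ⟩
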